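/- Let $M_0=\Gamma_0\backslash\tilde M_0$ be a closed developable Riemannian orbifold, i.e. $\tilde M_0$ is a connected, simply connected smooth Riemannian manifold and $\Gamma_0$ is a cocompact discrete group of isometries of $\tilde M_0$. Let $M$ be a connected closed smooth Riemannian manifold, let $q\colon M\to M_0$ be a Galois (orbifold) Riemannian covering with finite group $G$ (so $G$ acts faithfully by isometries on $M$ with $G\backslash M=M_0$), let $H_1\le G$ be a subgroup, and let $q_1\colon M\to M_1=H_1\backslash M$ be a Galois Riemannian covering with group $H_1$, where $M_1$ is a manifold and $q$ factors as $q=p_1\circ q_1$ through a Riemannian covering $p_1\colon M_1\to M_0$. Let $\ell$ be a prime, $C=\mathbb Z/\ell\mathbb Z$ and $n=[G:H_1]$. Index the coordinates of $C^n$ by the cosets in $G/H_1$, let $G$ act on $C^n$ by permuting the coordinates in the way it permutes the cosets, and let $\tilde G=C^n\rtimes G$ be the resulting wreath product and $\tilde H_1=C^n\rtimes H_1$ its subgroup corresponding to $H_1$. Let $\mathrm{Ind}_{H_1}^G\mathbf 1$ denote the $\mathbb Z[G]$-module of the permutation representation of $G$ on $G/H_1$. Consider the two statements: (A) There are a connected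 closed smooth Riemannian manifold $M'$, an action of $\tilde G$ on $M'$ by isometries, and a Riemannian covering $\pi\colon M'\to M$ that is equivariant with respect to the projection $\tilde G\to G$, such that $\pi\colon M'\to M$, $q_1\circ\pi\colon M'\to M_1$ and $q\circ\pi\colon M'\to M_0$ are Galois coverings with groups $C^n$, $\tilde H_1$ and $\tilde G$, respectively. (B) $(\mathrm{Ind}_{H_1}^G\mathbf 1)\otimes_{\mathbb Z}\mathbb F_\ell$ is a quotient of the $\mathbb F_\ell[G]$-module $\mathrm H_1(M,\mathbb F_\ell)$. Then (A) implies (B). If moreover $\ell$ does not divide $|G|$, then (A) and (B) are equivalent. -/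

import Mathlib

open scoped Manifold ContDiff TensorProduct

universe u

noncomputable section

/-- A connected smooth Riemannian manifold of dimension `d` (Hausdorff, second countable, without
boundary). -/
structure RiemMfd (d : ℕ) where
  carrier : Type u
  [top : TopologicalSpace carrier]
  [charted : ChartedSpace (EuclideanSpace ℝ (Fin d)) carrier]
  [smooth : IsManifold (𝓡 d) ∞ carrier]
  [t2 : T2Space carrier]
  [secondCountable : SecondCountableTopology carrier]
  [connected : ConnectedSpace carrier]
  /-- The Riemannian metric. -/
  metric : Bundle.ContMDiffRiemannianMetric (𝓡 d) ∞ (EuclideanSpace ℝ (Fin d))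
    (fun x : carrier => TangentSpace (𝓡 d) x)

namespace RiemMfd

instance (d : ℕ) : CoeSort (RiemMfd.{u} d) (Type u) := ⟨RiemMfd.carrier⟩

attribute [instance] top charted smooth t2 secondCountable connected

variable {d : ℕ}

/-- `f` is smooth and its differential preserves the Riemannian metric at each point. As source and
target have the same dimension, this says that `f` is a local isometry of Riemannian manifolds. -/
structure IsLocalIsometry {X Y : RiemMfd.{u} d} (f : X → Y) : Prop where
  contMDiff : ContMDiff (𝓡 d) (𝓡 d) ∞ f
  inner_mfderiv : ∀ (x : X) (v w : TangentSpace (𝓡 d) x),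
    Y.metric.inner (f x) (mfderiv (𝓡 d) (𝓡 d) f x v) (mfderiv (𝓡 d) (𝓡 d) f x w)
      = X.metric.inner x v w

/-- `f` is a Riemannian covering. -/
structure IsRiemannianCovering {X Y : RiemMfd.{u} d} (f : X → Y) : Prop where
  isCoveringMap : IsCoveringMap f
  surjective : Function.Surjective f
  isLocalIsometry : IsLocalIsometry f

/-- The group `K` acts on `X` by isometries. (Each element acts bijectively, so a smooth map
preserving the metric is an isometry.) -/
def ActsByIsometries (K : Type*) [Group K] (X : RiemMfd.{u} d) [MulAction K X] : Prop :=
  ∀ k : K, IsLocalIsometry (fun x : X => k • x)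

/-- `f : X → Y` is a Galois Riemannian covering with group `K`: the group `K` acts freely on `X`
by isometries, and the fibres of the Riemannian covering `f` are the `K`-orbits,
so that `Y = K \ X`. -/
structure IsGaloisCovering (K : Type*) [Group K] {X Y : RiemMfd.{u} d} [MulAction K X]
    (f : X → Y) : Prop where
  isRiemannianCovering : IsRiemannianCovering f
  actsByIsometries : ActsByIsometries K X
  free : ∀ (k : K) (x : X), k • x = x → k = 1
  fibre : ∀ x y : X, f x = f y ↔ ∃ k : K, k • x = y

end RiemMfd

/-- A closed developable Riemannian orbifold of dimension `d`: the quotient of a connected and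
simply connected Riemannian manifold by a cocompact discrete (equivalently, cocompact and properly
discontinuous) group of isometries. -/
structure DevelopableOrbifold (d : ℕ) where
  /-- The universal covering manifold. -/
  cover : RiemMfd.{u} d
  [simplyConnected : SimplyConnectedSpace cover]
  /-- The orbifold fundamental group. -/
  group : Subgroup (Equiv.Perm cover)
  isometries : RiemMfd.ActsByIsometries group cover
  discrete : ProperlyDiscontinuousSMul group cover
  cocompact : CompactSpace (MulAction.orbitRel.Quotient group cover)

namespace DevelopableOrbifold

variable {d : ℕ}

/-- The underlying space of the orbifold. -/
abbrev Space (O : DevelopableOrbifold.{u} d) : Type u :=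
  MulAction.orbitRel.Quotient O.group O.cover

/-- The quotient map from the universal covering manifold to the underlying space. -/
def proj (O : DevelopableOrbifold.{u} d) (x : O.cover) : O.Space :=
  Quotient.mk (MulAction.orbitRel O.group O.cover) x

/-- `p : X → O` is a Riemannian (orbifold) covering of `O` by the manifold `X`: up to isometry over
`O`, it is `Γ' \ cover → group \ cover` for a subgroup `Γ'` of the orbifold fundamental group
that acts on `cover` without fixed points. -/
def IsCovering (O : DevelopableOrbifold.{u} d) {X : RiemMfd.{u} d} (p : X → O.Space) : Prop :=
  ∃ (Γ' : Subgroup O.group) (π : O.cover → X), RiemMfd.IsGaloisCovering Γ' π ∧ p ∘ π = O.proj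

/-- `p : X → O` is a Galois (orbifold) covering with finite group `K`: the group `K` acts
faithfully on `X` by isometries, and the fibres of the covering `p` are the `K`-orbits, so that
`O = K \ X`. The action need not be free, as `O` is an orbifold. -/
structure IsGaloisCovering (O : DevelopableOrbifold.{u} d) (K : Type*) [Group K]
    {X : RiemMfd.{u} d} [MulAction K X] (p : X → O.Space) : Prop where
  isCovering : O.IsCovering p
  finite : Finite K
  actsByIsometries : RiemMfd.ActsByIsometries K X
  faithful : FaithfulSMul K X
  fibre : ∀ x y : X, p x = p y ↔ ∃ k : K, k • x = y

end DevelopableOrbifold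

section Wreath

variable (ℓ : ℕ) {G : Type*} [Group G] (H : Subgroup G)

/-- The wreath product `C^n ⋊ G`, where `C = ℤ/ℓ` (written multiplicatively), `n = [G : H]`, the
coordinates of `C^n` are indexed by the cosets of `H` in `G`, and `g ∈ G` acts on `C^n` by
`(g • k) c = k (g⁻¹ • c)`. -/
abbrev WreathProduct : Type _ :=
  (G ⧸ H → Multiplicative (ZMod ℓ)) ⋊[mulAutArrow (G := G)] G

/-- The subgroup `C^n` of `C^n ⋊ G`. -/
def WreathProduct.base : Subgroup (WreathProduct ℓ H) :=
  (SemidirectProduct.inl :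
    (G ⧸ H → Multiplicative (ZMod ℓ)) →* WreathProduct ℓ H).range

/-- The subgroup `C^n ⋊ H` of `C^n ⋊ G`. -/
def WreathProduct.overSubgroup : Subgroup (WreathProduct ℓ H) :=
  H.comap (SemidirectProduct.rightHom : WreathProduct ℓ H →* G)

/-- The `𝔽_ℓ[G]`-module `(Ind_H^G 1) ⊗_ℤ 𝔽_ℓ`, where `Ind_H^G 1` is the `ℤ[G]`-module of the
permutation representation of `G` on the cosets of `H`. -/
def indTrivialMod : Representation (ZMod ℓ) G (ZMod ℓ ⊗[ℤ] MonoidAlgebra ℤ (G ⧸ H)) where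
  toFun g := (Representation.ofMulAction ℤ G (G ⧸ H) g).baseChange (ZMod ℓ)
  map_one' := by rw [map_one]; exact LinearMap.baseChange_id
  map_mul' g h := by rw [map_mul]; exact LinearMap.baseChange_comp _ _

end Wreath

section Homology

open CategoryTheory

/-- The first singular homology `H_1(X, 𝔽_ℓ)`. -/
abbrev firstHomology (ℓ : ℕ) (X : Type u) [TopologicalSpace X] : ModuleCat.{u} (ZMod ℓ) :=
  ((AlgebraicTopology.singularHomologyFunctor (ModuleCat.{u} (ZMod ℓ)) 1).obj
    (ModuleCat.of (ZMod ℓ) (ULift.{u} (ZMod ℓ)))).obj (TopCat.of X)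

/-- The `𝔽_ℓ[G]`-module structure on `H_1(X, 𝔽_ℓ)` induced by an action of `G` on `X`. -/
def firstHomologyRep (ℓ : ℕ) (G : Type*) [Group G] (X : Type u) [TopologicalSpace X]
    [MulAction G X] [ContinuousConstSMul G X] :
    Representation (ZMod ℓ) G (firstHomology ℓ X) where
  toFun g := (((AlgebraicTopology.singularHomologyFunctor (ModuleCat.{u} (ZMod ℓ)) 1).obj
    (ModuleCat.of (ZMod ℓ) (ULift.{u} (ZMod ℓ)))).map
      (TopCat.ofHom (⟨fun x => g • x, continuous_const_smul g⟩ : C(X, X)))).hom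
  map_one' := by
    have : TopCat.ofHom (⟨fun x => (1 : G) • x, continuous_const_smul 1⟩ : C(X, X))
        = 𝟙 (TopCat.of X) := by ext x; simp
    rw [this, CategoryTheory.Functor.map_id]; rfl
  map_mul' g h := by
    have : TopCat.ofHom (⟨fun x => (g * h) • x, continuous_const_smul (g * h)⟩ : C(X, X))
        = TopCat.ofHom (⟨fun x => h • x, continuous_const_smul h⟩ : C(X, X)) ≫
          TopCat.ofHom (⟨fun x => g • x, continuous_const_smul g⟩ : C(X, X)) := by
      ext x; simp [mul_smul]
    rw [this, CategoryTheory.Functor.map_comp]; rfl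

end Homology

/-- The representation `σ` is a quotient module of the representation `ρ`. -/
def IsQuotientModule {k G V W : Type*} [CommRing k] [Group G] [AddCommGroup V] [Module k V]
    [AddCommGroup W] [Module k W] (ρ : Representation k G V) (σ : Representation k G W) : Prop :=
  ∃ φ : Representation.IntertwiningMap ρ σ, Function.Surjective φ

/-- The diagram of coverings `M → M₁ → M₀`, `M → M₀` with groups `H` (for `q₁ : M → M₁`) and `G`
(for `q : M → M₀`) extends by a closed connected Riemannian manifold `M'`, on which the
wreath product `C^n ⋊ G` acts by isometries, and a covering `π : M' → M`, compatible with the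
actions of `C^n ⋊ G` on `M'` and `G` on `M`, such that `π : M' → M`, `q₁ ∘ π : M' → M₁` and
`q ∘ π : M' → M₀` are Galois coverings with groups `C^n`, `C^n ⋊ H` and `C^n ⋊ G`. -/
def ExtendsToWreathCover (ℓ : ℕ) {d : ℕ} {G : Type*} [Group G] (H : Subgroup G)
    {M₀ : DevelopableOrbifold.{u} d} {M M₁ : RiemMfd.{u} d} [MulAction G M]
    (q : M → M₀.Space) (q₁ : M → M₁) : Prop :=
  ∃ (M' : RiemMfd.{u} d) (_ : MulAction (WreathProduct ℓ H) M') (π : M' → M),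
    CompactSpace M' ∧
    (∀ (γ : WreathProduct ℓ H) (x : M'), π (γ • x) = γ.right • π x) ∧
    RiemMfd.IsGaloisCovering (WreathProduct.base ℓ H) π ∧
    RiemMfd.IsGaloisCovering (WreathProduct.overSubgroup ℓ H) (q₁ ∘ π) ∧
    M₀.IsGaloisCovering (WreathProduct ℓ H) (q ∘ π)

end

/-! Write V for C^n as an 𝔽_ℓ-module. Conjugation by G inside the wreath product makes V the
permutation module on G/H₁ (`inr_mul_wreathVec`), and this module is the induced module of (B). Both
directions rest on the correspondence between connected coverings of M with group V and surjections
H₁(M, 𝔽_ℓ) → V, obtained here by evaluating singular 1-cocycles.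

From (A) to (B): the displacement of lifted paths in M', measured against a set-theoretic section of
π, is a V-valued 1-cocycle on M and so induces φ : H₁(M, 𝔽_ℓ) → V. It is onto because M' is path
connected. The element g of the complement G of V acts on M' over the action of g on M and twists
translations by the permutation action, so φ is G-equivariant
(`IsCoveringMap.exists_homology_surjection`).

From (B) to (A): write M = Γ \ X with X the simply connected cover of M₀. A cocycle representing φ
becomes a coboundary df on X, and γ ↦ f(γx) − f(x) is a surjection ψ : Γ → V (`exists_deck_hom`).
The quotient E = ker ψ \ X covers M with group V. Equivariance of φ forces lifts to X of elements of
G to preserve ker ψ, so they descend to E (`DeckQuotient.exists_isEquivariantLift`). All such lifts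
form an extension of G by V; as |V| is a power of ℓ and ℓ ∤ |G|, it splits by Schur–Zassenhaus
(`IsCoveringMap.exists_lift_action`). This is the only use of ℓ ∤ |G|. The splitting yields an
action of V ⋊ G on E, which is isometric for the metric pulled back from M
(`extendsToWreathCover_of_lift`). -/

noncomputable section

/-! ### Singular 1-cocycles and linear maps on first homology -/

section SingularChains

open CategoryTheory AlgebraicTopology Simplicial

variable (ℓ : ℕ)

/-- Singular simplices. -/
abbrev Sing (n : ℕ) (X : Type*) [TopologicalSpace X] := C(stdSimplex ℝ (Fin (n + 1)), X)

/-- The inclusion of the `i`-th face of the standard simplex. -/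
def simplexFace {n : ℕ} (i : Fin (n + 2)) :
    C(stdSimplex ℝ (Fin (n + 1)), stdSimplex ℝ (Fin (n + 2))) :=
  ⟨stdSimplex.map i.succAbove, stdSimplex.continuous_map _⟩

variable {X Y : Type u} [TopologicalSpace X] [TopologicalSpace Y]

/-- The coefficient module of singular homology. -/
abbrev singCoeff : ModuleCat.{u} (ZMod ℓ) := ModuleCat.of (ZMod ℓ) (ULift.{u} (ZMod ℓ))

variable (X) in
/-- The singular chain complex. -/
abbrev singComplex : ChainComplex (ModuleCat.{u} (ZMod ℓ)) ℕ :=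
  (TopCat.toSSet.obj (TopCat.of X)).chainComplex (singCoeff.{u} ℓ)

/-- The map on singular chains induced by a continuous map. -/
abbrev singMap (f : C(X, Y)) : singComplex ℓ X ⟶ singComplex ℓ Y :=
  SSet.chainComplexMap (TopCat.toSSet.map (TopCat.ofHom f)) (singCoeff.{u} ℓ)

/-- A singular simplex as a singular chain. -/
def singGen {n : ℕ} (σ : Sing n X) : (singComplex ℓ X).X n :=
  (SSet.ιChainComplex (R := singCoeff.{u} ℓ) (TopCat.toSSet.obj (TopCat.of X))
    (((TopCat.of X).toSSetObjEquiv (.op ⦋n⦌)).symm σ)).hom (ULift.up 1)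

lemma singComplex_d_gen {n : ℕ} (σ : Sing (n + 1) X) :
    (singComplex ℓ X).d (n + 1) n (singGen ℓ σ) =
      ∑ i : Fin (n + 2), (-1 : ℤ) ^ i.val • singGen ℓ (σ.comp (simplexFace i)) := by
  have h := SSet.ιChainComplex_d (R := singCoeff.{u} ℓ) (TopCat.toSSet.obj (TopCat.of X))
    (((TopCat.of X).toSSetObjEquiv (.op ⦋n + 1⦌)).symm σ)
  have h' := congrArg (fun f => f.hom (ULift.up 1)) h
  refine h'.trans ?_
  simp only [ModuleCat.hom_sum, LinearMap.sum_apply, ModuleCat.hom_zsmul, LinearMap.smul_apply]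
  rfl

lemma singMap_gen {n : ℕ} (f : C(X, Y)) (σ : Sing n X) :
    (singMap ℓ f).f n (singGen ℓ σ) = singGen ℓ (f.comp σ) := by
  have h := SSet.ι_chainComplexMap_f _ _
    (TopCat.toSSet.map (TopCat.ofHom f)) (singCoeff.{u} ℓ)
    (((TopCat.of X).toSSetObjEquiv (.op ⦋n⦌)).symm σ)
  exact congrArg (fun f => f.hom (ULift.up 1)) h

/-- The chain module is a coproduct, indexed by the simplices, of copies of the coefficient module,
each of which is spanned by `1`. -/
lemma singChain_hom_ext' {n : ℕ} {T : ModuleCat.{u} (ZMod ℓ)}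
    {f g : (singComplex ℓ X).X n ⟶ T}
    (h : ∀ σ : Sing n X, f (singGen ℓ σ) = g (singGen ℓ σ)) : f = g := by
  refine SSet.chainComplex_hom_ext fun x => ?_
  ext r
  obtain ⟨σ, rfl⟩ := ((TopCat.of X).toSSetObjEquiv (.op ⦋n⦌)).symm.surjective x
  have := congrArg (fun t => r.down • t) (h σ)
  simp only [← map_smul] at this
  have e : r.down • singGen ℓ σ = (SSet.ιChainComplex (R := singCoeff.{u} ℓ)
    (TopCat.toSSet.obj (TopCat.of X))
    (((TopCat.of X).toSSetObjEquiv (.op ⦋n⦌)).symm σ)).hom r := by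
    rw [singGen, ← map_smul]; congr 1; ext; simp
  rw [e] at this
  exact this

lemma exists_singChain_lift' {n : ℕ} (T : ModuleCat.{u} (ZMod ℓ)) (c : Sing n X → T) :
    ∃ L : (singComplex ℓ X).X n ⟶ T, ∀ σ, L (singGen ℓ σ) = c σ := by
  let s := (TopCat.toSSet.obj (TopCat.of X)).isColimitChainComplexXCofan (singCoeff.{u} ℓ) n
  let g : ∀ x, singCoeff.{u} ℓ ⟶ T := fun x => ModuleCat.ofHom
    ((LinearMap.toSpanSingleton (ZMod ℓ) T (c ((TopCat.of X).toSSetObjEquiv (.op ⦋n⦌) x))).comp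
      ULift.moduleEquiv.toLinearMap)
  refine ⟨Limits.Cofan.IsColimit.desc s g, fun σ => ?_⟩
  have h := Limits.Cofan.IsColimit.fac s g (((TopCat.of X).toSSetObjEquiv (.op ⦋n⦌)).symm σ)
  refine (congrArg (fun f => f.hom (ULift.up 1)) h).trans ?_
  simp only [g, ModuleCat.hom_ofHom, LinearMap.comp_apply, Equiv.apply_symm_apply]
  exact one_smul _ _

variable (X) in
-- The projection modulo the span kills all generators, hence is zero.
lemma span_singGen (n : ℕ) :
    Submodule.span (ZMod ℓ) (Set.range (singGen ℓ : Sing n X → (singComplex ℓ X).X n)) = ⊤ := by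
  set S := Submodule.span (ZMod ℓ) (Set.range (singGen ℓ : Sing n X → (singComplex ℓ X).X n))
  have h : ModuleCat.ofHom S.mkQ = 0 := by
    refine singChain_hom_ext' ℓ fun σ => ?_
    exact (Submodule.Quotient.mk_eq_zero _).2 (Submodule.subset_span ⟨σ, rfl⟩)
  have h' : S.mkQ = 0 := congrArg ModuleCat.Hom.hom h
  rw [← S.ker_mkQ, h', LinearMap.ker_zero]

lemma singChain_hom_ext {n : ℕ} {T : Type*} [AddCommGroup T] [Module (ZMod ℓ) T]
    {f g : (singComplex ℓ X).X n →ₗ[ZMod ℓ] T}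
    (h : ∀ σ : Sing n X, f (singGen ℓ σ) = g (singGen ℓ σ)) : f = g :=
  LinearMap.ext_on_range (span_singGen ℓ X n) h

/-- The coproduct property only reaches targets in universe `u`; mapping first to the free module on
the simplices, which lies there, frees the universe of `T`. -/
lemma exists_singChain_lift {n : ℕ} {T : Type*} [AddCommGroup T] [Module (ZMod ℓ) T]
    (c : Sing n X → T) :
    ∃ L : (singComplex ℓ X).X n →ₗ[ZMod ℓ] T, ∀ σ, L (singGen ℓ σ) = c σ := by
  obtain ⟨L, hL⟩ := exists_singChain_lift' ℓ (ModuleCat.of (ZMod ℓ) (Sing n X →₀ ZMod ℓ))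
    (fun σ => Finsupp.single σ 1)
  refine ⟨(Finsupp.linearCombination (ZMod ℓ) c).comp L.hom, fun σ => ?_⟩
  have := hL σ
  simp only [LinearMap.comp_apply]
  erw [this]
  simp

/-! ### Cocycles and the dual of the first homology -/

lemma homologyπ_surjective (K : ChainComplex (ModuleCat.{u} (ZMod ℓ)) ℕ) (n : ℕ) :
    Function.Surjective (K.homologyπ n) :=
  (ModuleCat.epi_iff_surjective _).1 inferInstance

lemma iCycles_injective (K : ChainComplex (ModuleCat.{u} (ZMod ℓ)) ℕ) (n : ℕ) :
    Function.Injective (K.iCycles n) :=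
  (ModuleCat.mono_iff_injective _).1 inferInstance

lemma exists_iCycles_eq (K : ChainComplex (ModuleCat.{u} (ZMod ℓ)) ℕ) {z : K.X 1}
    (hz : K.d 1 0 z = 0) : ∃ w, K.iCycles 1 w = z := by
  have h := ShortComplex.exact_of_f_is_kernel (ShortComplex.mk _ _ (K.iCycles_d 1 0))
    (K.cyclesIsKernel 1 0 (by simp))
  exact (ShortComplex.moduleCat_exact_iff _).1 h z hz

lemma iCycles_d_apply (K : ChainComplex (ModuleCat.{u} (ZMod ℓ)) ℕ) (w : K.cycles 1) :
    K.d 1 0 (K.iCycles 1 w) = 0 :=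
  congrArg (fun f => f.hom w) (K.iCycles_d 1 0)

lemma exists_toCycles_eq (K : ChainComplex (ModuleCat.{u} (ZMod ℓ)) ℕ) {w : K.cycles 1}
    (hw : K.homologyπ 1 w = 0) : ∃ t, K.toCycles 2 1 t = w := by
  have h := ShortComplex.exact_of_g_is_cokernel
    (ShortComplex.mk _ _ (K.toCycles_comp_homologyπ 2 1)) (K.homologyIsCokernel 2 1 (by simp))
  exact (ShortComplex.moduleCat_exact_iff _).1 h w hw

/-- A linear map factors through a surjective one with smaller kernel. -/
lemma LinearMap.exists_comp_eq_of_surjective {k A B T : Type*} [Ring k] [AddCommGroup A]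
    [Module k A] [AddCommGroup B] [Module k B] [AddCommGroup T] [Module k T] {f : A →ₗ[k] B}
    {h : A →ₗ[k] T} (hf : Function.Surjective f) (hfh : LinearMap.ker f ≤ LinearMap.ker h) :
    ∃ g : B →ₗ[k] T, ∀ a, g (f a) = h a := by
  refine ⟨((LinearMap.ker f).liftQ h hfh).comp
    (f.quotKerEquivOfSurjective hf).symm.toLinearMap, fun a => ?_⟩
  have : (f.quotKerEquivOfSurjective hf).symm (f a) = (LinearMap.ker f).mkQ a := by
    rw [LinearEquiv.symm_apply_eq]; rfl
  simp [this]

/-- Over a field, a linear map factors through any linear map with smaller kernel. -/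
lemma LinearMap.exists_comp_eq_of_ker_le {k A B T : Type*} [Field k] [AddCommGroup A]
    [Module k A] [AddCommGroup B] [Module k B] [AddCommGroup T] [Module k T] {f : A →ₗ[k] B}
    {h : A →ₗ[k] T} (hfh : LinearMap.ker f ≤ LinearMap.ker h) :
    ∃ g : B →ₗ[k] T, ∀ a, g (f a) = h a := by
  obtain ⟨g, hg⟩ := LinearMap.exists_comp_eq_of_surjective (f := f.rangeRestrict) (h := h)
    f.surjective_rangeRestrict (by rwa [LinearMap.ker_rangeRestrict])
  obtain ⟨g', hg'⟩ := g.exists_extend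
  refine ⟨g', fun a => ?_⟩
  rw [← hg a, ← hg']
  rfl

/-- The vertices of the standard simplex. -/
abbrev simplexVertex {n : ℕ} (i : Fin (n + 1)) : stdSimplex ℝ (Fin (n + 1)) :=
  stdSimplex.vertex i

lemma simplexFace_vertex {n : ℕ} (i : Fin (n + 2)) (j : Fin (n + 1)) :
    simplexFace i (simplexVertex j) = simplexVertex (i.succAbove j) :=
  stdSimplex.map_vertex _ _

/-- The faces of a singular `1`-simplex are its end points. -/
lemma comp_simplexFace_zero_dim (σ : Sing 1 X) (i : Fin 2) :
    σ.comp (simplexFace i) = ContinuousMap.const _ (σ (simplexVertex (i.succAbove 0))) := by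
  ext t
  rw [Subsingleton.elim t (simplexVertex 0)]
  simp [simplexFace_vertex]

/-- A singular `0`-simplex as a chain. -/
def singPoint (x : X) : (singComplex ℓ X).X 0 := singGen ℓ (ContinuousMap.const _ x)

lemma singComplex_d_one (σ : Sing 1 X) :
    (singComplex ℓ X).d 1 0 (singGen ℓ σ) =
      singPoint ℓ (σ (simplexVertex 1)) - singPoint ℓ (σ (simplexVertex 0)) := by
  rw [singComplex_d_gen, Fin.sum_univ_two, comp_simplexFace_zero_dim, comp_simplexFace_zero_dim]
  simp [singPoint, sub_eq_add_neg]

lemma singComplex_d_two (σ : Sing 2 X) :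
    (singComplex ℓ X).d 2 1 (singGen ℓ σ) =
      singGen ℓ (σ.comp (simplexFace 0)) - singGen ℓ (σ.comp (simplexFace 1))
        + singGen ℓ (σ.comp (simplexFace 2)) := by
  rw [singComplex_d_gen, Fin.sum_univ_three]
  simp [sub_eq_add_neg]

/-- A singular `1`-cochain with values in `T` is a cocycle. -/
def IsSingCocycle {T : Type*} [AddCommGroup T] (c : Sing 1 X → T) : Prop :=
  ∀ τ : Sing 2 X, c (τ.comp (simplexFace 1))
    = c (τ.comp (simplexFace 2)) + c (τ.comp (simplexFace 0))

variable {T T' : Type*} [AddCommGroup T] [Module (ZMod ℓ) T] [AddCommGroup T']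
  [Module (ZMod ℓ) T']

/-- The homology class of a cycle. -/
def singClass : (singComplex ℓ X).cycles 1 →ₗ[ZMod ℓ] firstHomology ℓ X :=
  ((singComplex ℓ X).homologyπ 1).hom

/-- The linear form `φ` on the first homology is the one induced by the cocycle `c`. -/
def Represents (c : Sing 1 X → T) (φ : firstHomology ℓ X →ₗ[ZMod ℓ] T) : Prop :=
  ∃ L : (singComplex ℓ X).X 1 →ₗ[ZMod ℓ] T, (∀ σ, L (singGen ℓ σ) = c σ) ∧
    ∀ z : (singComplex ℓ X).cycles 1,
      φ (singClass ℓ z) = L ((singComplex ℓ X).iCycles 1 z)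

/-- The linear extension of a cocycle kills boundaries, so its restriction to cycles descends to
homology. -/
lemma IsSingCocycle.exists_represents {c : Sing 1 X → T} (hc : IsSingCocycle c) :
    ∃ φ : firstHomology ℓ X →ₗ[ZMod ℓ] T, Represents ℓ c φ := by
  obtain ⟨L, hL⟩ := exists_singChain_lift ℓ c
  have hLd : L.comp ((singComplex ℓ X).d 2 1).hom = 0 := by
    refine singChain_hom_ext ℓ fun τ => ?_
    have : L ((singComplex ℓ X).d 2 1 (singGen ℓ τ)) = 0 := by
      rw [singComplex_d_two, map_add, map_sub, hL, hL, hL, hc τ]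
      abel
    exact this
  obtain ⟨φ, hφ⟩ := LinearMap.exists_comp_eq_of_surjective
    (f := singClass ℓ) (h := L.comp ((singComplex ℓ X).iCycles 1).hom)
    (homologyπ_surjective ℓ _ 1) (fun w hw => by
      obtain ⟨t, rfl⟩ := exists_toCycles_eq ℓ _ hw
      have h : (singComplex ℓ X).iCycles 1 ((singComplex ℓ X).toCycles 2 1 t)
          = (singComplex ℓ X).d 2 1 t :=
        congrArg (fun f => f.hom t) ((singComplex ℓ X).toCycles_i 2 1)
      have h' : L ((singComplex ℓ X).d 2 1 t) = 0 := LinearMap.congr_fun hLd t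
      rw [← h] at h'
      exact h')
  exact ⟨φ, L, hL, hφ⟩

/-- The class of the boundary of a 2-simplex is zero. -/
lemma Represents.isSingCocycle {c : Sing 1 X → T} {φ : firstHomology ℓ X →ₗ[ZMod ℓ] T}
    (h : Represents ℓ c φ) : IsSingCocycle c := by
  obtain ⟨L, hL, hφ⟩ := h
  intro τ
  have h1 := hφ ((singComplex ℓ X).toCycles 2 1 (singGen ℓ τ))
  have h2 : (singComplex ℓ X).iCycles 1 ((singComplex ℓ X).toCycles 2 1 (singGen ℓ τ))
      = (singComplex ℓ X).d 2 1 (singGen ℓ τ) :=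
    congrArg (fun f => f.hom (singGen ℓ τ)) ((singComplex ℓ X).toCycles_i 2 1)
  have h3 : singClass ℓ ((singComplex ℓ X).toCycles 2 1 (singGen ℓ τ)) = 0 :=
    congrArg (fun f => f.hom (singGen ℓ τ)) ((singComplex ℓ X).toCycles_comp_homologyπ 2 1)
  rw [h2, h3, map_zero, singComplex_d_two, map_add, map_sub, hL, hL, hL] at h1
  rw [← sub_eq_zero, ← neg_eq_zero, h1]
  abel

/-- Over the field 𝔽_ℓ, a linear map on cycles extends to all chains. -/
lemma exists_represents [Fact ℓ.Prime] (φ : firstHomology ℓ X →ₗ[ZMod ℓ] T) :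
    ∃ c : Sing 1 X → T, Represents ℓ c φ := by
  obtain ⟨L, hL⟩ := LinearMap.exists_comp_eq_of_ker_le
    (f := ((singComplex ℓ X).iCycles 1).hom) (h := φ.comp (singClass ℓ))
    (by rw [LinearMap.ker_eq_bot.2 (iCycles_injective ℓ _ 1)]; exact bot_le)
  exact ⟨fun σ => L (singGen ℓ σ), L, fun _ => rfl, fun z => (hL z).symm⟩

/-- Every loop defines a homology class, on which a linear form is evaluated by evaluating a
representing cocycle on the loop. -/
lemma exists_loopClass (σ : Sing 1 X) (hσ : σ (simplexVertex 0) = σ (simplexVertex 1)) :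
    ∃ s : firstHomology ℓ X, ∀ (c : Sing 1 X → T) (φ : firstHomology ℓ X →ₗ[ZMod ℓ] T),
      Represents ℓ c φ → φ s = c σ := by
  obtain ⟨w, hw⟩ := exists_iCycles_eq ℓ (singComplex ℓ X) (z := singGen ℓ σ)
    (by rw [singComplex_d_one, hσ, sub_self])
  refine ⟨singClass ℓ w, ?_⟩
  rintro c φ ⟨L, hL, hφ⟩
  rw [hφ, hw, hL]

/-- Cohomologous cocycles agree on cycles: their difference factors through the differential. -/
lemma Represents.ext {c c' : Sing 1 X → T} {φ φ' : firstHomology ℓ X →ₗ[ZMod ℓ] T}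
    (h : Represents ℓ c φ) (h' : Represents ℓ c' φ') (b : X → T)
    (hb : ∀ σ, c σ - c' σ = b (σ (simplexVertex 1)) - b (σ (simplexVertex 0))) : φ = φ' := by
  obtain ⟨L, hL, hφ⟩ := h
  obtain ⟨L', hL', hφ'⟩ := h'
  obtain ⟨B, hB⟩ := exists_singChain_lift ℓ (n := 0) (X := X)
    (fun σ => b (σ (simplexVertex 0)))
  have hBd : B.comp ((singComplex ℓ X).d 1 0).hom = L - L' := by
    refine singChain_hom_ext ℓ fun σ => ?_
    rw [LinearMap.sub_apply, hL, hL', hb]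
    have : B ((singComplex ℓ X).d 1 0 (singGen ℓ σ))
        = b (σ (simplexVertex 1)) - b (σ (simplexVertex 0)) := by
      rw [singComplex_d_one, map_sub, singPoint, singPoint, hB, hB]
      rfl
    exact this
  ext s
  obtain ⟨w, rfl⟩ := homologyπ_surjective ℓ (singComplex ℓ X) 1 s
  have h1 : B ((singComplex ℓ X).d 1 0 ((singComplex ℓ X).iCycles 1 w))
      = (L - L') ((singComplex ℓ X).iCycles 1 w) := by rw [← hBd]; rfl
  rw [iCycles_d_apply, map_zero, LinearMap.sub_apply, ← hφ, ← hφ'] at h1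
  exact (sub_eq_zero.1 h1.symm)

/-- The difference of the two cochains vanishes on cycles, the kernel of the differential, so over a
field it factors through the differential; the factor restricted to points is `b`. -/
lemma Represents.exists_coboundary [Fact ℓ.Prime] {c c' : Sing 1 X → T}
    {φ : firstHomology ℓ X →ₗ[ZMod ℓ] T} (h : Represents ℓ c φ) (h' : Represents ℓ c' φ) :
    ∃ b : X → T, ∀ σ, c σ - c' σ = b (σ (simplexVertex 1)) - b (σ (simplexVertex 0)) := by
  obtain ⟨L, hL, hφ⟩ := h
  obtain ⟨L', hL', hφ'⟩ := h'
  obtain ⟨B, hB⟩ := LinearMap.exists_comp_eq_of_ker_le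
    (f := ((singComplex ℓ X).d 1 0).hom) (h := L - L') (fun z hz => by
      obtain ⟨w, rfl⟩ := exists_iCycles_eq ℓ _ hz
      have : (L - L') ((singComplex ℓ X).iCycles 1 w) = 0 := by
        rw [LinearMap.sub_apply, ← hφ, ← hφ', sub_self]
      exact this)
  refine ⟨fun x => B (singPoint ℓ x), fun σ => ?_⟩
  have h1 : B ((singComplex ℓ X).d 1 0 (singGen ℓ σ)) = (L - L') (singGen ℓ σ) := hB _
  rw [singComplex_d_one, map_sub, LinearMap.sub_apply, hL, hL'] at h1
  exact h1.symm

/-- The map on the first homology induced by a continuous map. -/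
def firstHomologyMap (f : C(X, Y)) : firstHomology ℓ X →ₗ[ZMod ℓ] firstHomology ℓ Y :=
  (((singularHomologyFunctor (ModuleCat.{u} (ZMod ℓ)) 1).obj (singCoeff.{u} ℓ)).map
    (TopCat.ofHom f)).hom

lemma Represents.comp_map {c : Sing 1 Y → T} {φ : firstHomology ℓ Y →ₗ[ZMod ℓ] T}
    (h : Represents ℓ c φ) (f : C(X, Y)) :
    Represents ℓ (fun σ => c (f.comp σ)) (φ.comp (firstHomologyMap ℓ f)) := by
  obtain ⟨L, hL, hφ⟩ := h
  refine ⟨L.comp ((singMap ℓ f).f 1).hom, fun σ => ?_, fun z => ?_⟩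
  · exact (congrArg L (singMap_gen ℓ f σ)).trans (hL _)
  · have h1 : firstHomologyMap ℓ f (singClass ℓ z)
        = singClass ℓ (HomologicalComplex.cyclesMap (singMap ℓ f) 1 z) :=
      congrArg (fun f => f.hom z) (HomologicalComplex.homologyπ_naturality (singMap ℓ f) 1)
    have h2 : (singComplex ℓ Y).iCycles 1 (HomologicalComplex.cyclesMap (singMap ℓ f) 1 z)
        = (singMap ℓ f).f 1 ((singComplex ℓ X).iCycles 1 z) :=
      congrArg (fun f => f.hom z) (HomologicalComplex.cyclesMap_i (singMap ℓ f) 1)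
    rw [LinearMap.comp_apply, h1, hφ, h2]
    rfl

variable {ℓ} in
lemma Represents.map {c : Sing 1 X → T} {φ : firstHomology ℓ X →ₗ[ZMod ℓ] T}
    (h : Represents ℓ c φ) (A : T →ₗ[ZMod ℓ] T') :
    Represents ℓ (fun σ => A (c σ)) (A.comp φ) := by
  obtain ⟨L, hL, hφ⟩ := h
  exact ⟨A.comp L, fun σ => congrArg A (hL σ), fun z => congrArg A (hφ z)⟩

lemma firstHomologyRep_apply (G : Type*) [Group G] [MulAction G X] [ContinuousConstSMul G X]
    (g : G) : firstHomologyRep ℓ G X g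
      = firstHomologyMap ℓ ⟨fun x : X => g • x, continuous_const_smul g⟩ :=
  rfl

end SingularChains

/-! ### Smooth structure pulled back along a local homeomorphism -/

section PullbackManifold

open Topology Set Bundle

variable {H : Type*} [TopologicalSpace H] {M N : Type*} [TopologicalSpace M] [TopologicalSpace N]
  [ChartedSpace H M]

/-- The charts obtained by composing a local homeomorphism with the charts of its target. -/
@[reducible] def IsLocalHomeomorph.pullbackChartedSpace {p : N → M} (hp : IsLocalHomeomorph p) :
    ChartedSpace H N where
  atlas := range fun x => (hp.localInverseAt x).symm.trans (chartAt H (p x))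
  chartAt x := (hp.localInverseAt x).symm.trans (chartAt H (p x))
  mem_chart_source x := by simp
  chart_mem_atlas x := ⟨x, rfl⟩

/-- The charts of the source of `p` are the ones obtained by composing `p` with the charts of its
target. -/
def IsPullbackCharted (H : Type*) [TopologicalSpace H] [ChartedSpace H M] [ChartedSpace H N]
    (p : N → M) : Prop :=
  (∀ x : N, ∃ e : OpenPartialHomeomorph N M, x ∈ e.source ∧ ⇑e = p ∧
    chartAt H x = e.trans (chartAt H (p x))) ∧ ∀ c ∈ atlas H N, ∃ x, c = chartAt H x

lemma IsLocalHomeomorph.isPullbackCharted {p : N → M} (hp : IsLocalHomeomorph p) :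
    let _ := hp.pullbackChartedSpace (H := H)
    IsPullbackCharted H p := by
  let _ := hp.pullbackChartedSpace (H := H)
  refine ⟨fun x => ⟨(hp.localInverseAt x).symm, by simp, by simp, rfl⟩, ?_⟩
  rintro c ⟨x, rfl⟩
  exact ⟨x, rfl⟩

namespace IsPullbackCharted

variable {E : Type*} [NormedAddCommGroup E] [NormedSpace ℝ E] {I : ModelWithCorners ℝ E H}
  [ChartedSpace H N] {p : N → M}

lemma extChartAt_eq (h : IsPullbackCharted H p) (x : N) :
    ⇑(extChartAt I x) = extChartAt I (p x) ∘ p := by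
  obtain ⟨e, -, rfl, h2⟩ := h.1 x
  simp only [extChartAt, h2]
  rfl

/-- In these charts `p` is the identity, so coordinate changes upstairs are restrictions of those
downstairs. -/
lemma isManifold (h : IsPullbackCharted H p) {n : ℕ∞ω} [IsManifold I n M] : IsManifold I n N := by
  refine isManifold_of_contDiffOn I n N fun c c' hc hc' => ?_
  obtain ⟨x, rfl⟩ := h.2 c hc
  obtain ⟨y, rfl⟩ := h.2 c' hc'
  obtain ⟨e, -, he, hx⟩ := h.1 x
  obtain ⟨e', -, he', hy⟩ := h.1 y
  rw [hx, hy]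
  have key : ∀ z ∈ ((e.trans (chartAt H (p x))).symm ≫ₕ (e'.trans (chartAt H (p y)))).source,
      p (e.symm ((chartAt H (p x)).symm z)) = (chartAt H (p x)).symm z := fun z hz => by
    simp only [mfld_simps] at hz
    exact (congrFun he _).symm.trans (e.right_inv hz.1.2)
  have h1 := I.contDiffOn_extendCoordChange (n := n)
    (IsManifold.chart_mem_maximalAtlas (I := I) (n := n) (p x))
    (IsManifold.chart_mem_maximalAtlas (I := I) (n := n) (p y))
  refine (h1.mono ?_).congr ?_
  · rintro _ ⟨hz, ⟨z, rfl⟩⟩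
    rw [I.extendCoordChange_source]
    refine ⟨z, ?_, rfl⟩
    simp only [mem_preimage, I.left_inv] at hz
    have h2 := key z hz
    simp only [mfld_simps] at hz ⊢
    rw [he', h2] at hz
    exact ⟨hz.1.1, hz.2.2⟩
  · rintro _ ⟨hz, ⟨z, rfl⟩⟩
    simp only [mem_preimage, I.left_inv] at hz
    have h2 := key z hz
    simp only [Function.comp_apply, I.left_inv, mfld_simps, he', h2]

lemma contMDiffAt_of_comp (h : IsPullbackCharted H p) {E' H' L : Type*} [NormedAddCommGroup E']
    [NormedSpace ℝ E'] [TopologicalSpace H'] {J : ModelWithCorners ℝ E' H'} [TopologicalSpace L]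
    [ChartedSpace H' L] {n : ℕ∞ω} {f : L → N} {x : L} (hf : ContinuousAt f x)
    (hpf : ContMDiffAt J I n (p ∘ f) x) : ContMDiffAt J I n f x := by
  rw [contMDiffAt_iff_target] at hpf ⊢
  refine ⟨hf, ?_⟩
  rw [h.extChartAt_eq]
  exact hpf.2

lemma contMDiff (h : IsPullbackCharted H p) (hp : Continuous p) {n : ℕ∞ω} [IsManifold I n M] :
    ContMDiff I I n p := by
  have := h.isManifold (I := I) (n := n)
  intro x
  rw [contMDiffAt_iff_target]
  refine ⟨hp.continuousAt, ?_⟩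
  rw [← h.extChartAt_eq]
  exact contMDiffAt_extChartAt

/-- Equality of germs, not just of values, is what lets derivatives of the coordinate changes be
compared in `trivializationAt_symm_eq`. -/
lemma coordChange_eventuallyEq (h : IsPullbackCharted H p) (x₀ : N) :
    ∀ᶠ y in 𝓝 x₀, ∀ z : N, ∀ᶠ w in 𝓝 (extChartAt I x₀ y), w ∈ range I →
      (extChartAt I z ∘ (extChartAt I x₀).symm) w
        = (extChartAt I (p z) ∘ (extChartAt I (p x₀)).symm) w := by
  obtain ⟨e, hx, he, hc⟩ := h.1 x₀
  have hs : (chartAt H x₀).source ∈ 𝓝 x₀ := chart_source_mem_nhds H x₀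
  filter_upwards [hs] with y hy z
  have hext : (extChartAt I x₀).symm = e.symm ∘ (extChartAt I (p x₀)).symm := by
    simp only [extChartAt, hc]; rfl
  have hy2 : y ∈ e.source ∧ p y ∈ (chartAt H (p x₀)).source := by
    rw [hc, OpenPartialHomeomorph.trans_source] at hy
    exact ⟨hy.1, he ▸ hy.2⟩
  have hty : (extChartAt I (p x₀)).symm (extChartAt I x₀ y) = p y := by
    rw [h.extChartAt_eq]
    exact (extChartAt I (p x₀)).left_inv (by rw [extChartAt_source]; exact hy2.2)
  have hcont : ContinuousAt (extChartAt I (p x₀)).symm (extChartAt I x₀ y) := by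
    rw [h.extChartAt_eq]
    exact continuousAt_extChartAt_symm' (by rw [extChartAt_source]; exact hy2.2)
  have hmem : e.target ∈ 𝓝 ((extChartAt I (p x₀)).symm (extChartAt I x₀ y)) := by
    rw [hty]
    exact e.open_target.mem_nhds (he ▸ e.map_source hy2.1)
  filter_upwards [hcont.preimage_mem_nhds hmem] with w hw _
  rw [hext, h.extChartAt_eq]
  simp only [Function.comp_apply]
  exact congrArg _ ((congrFun he _).symm.trans (e.right_inv hw))

/-- The preferred charts at `x` and `p x` differ by `p` itself, so `p` reads as the identity in
them. -/
lemma hasMFDerivAt (h : IsPullbackCharted H p) (hp : Continuous p) (x : N) :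
    HasMFDerivAt I I p x (ContinuousLinearMap.id ℝ E) := by
  refine ⟨hp.continuousAt, ?_⟩
  refine (hasFDerivWithinAt_id (𝕜 := ℝ) (extChartAt I x x) (range I)).congr_of_eventuallyEq ?_ ?_
  · filter_upwards [extChartAt_target_mem_nhdsWithin x] with w hw
    have : writtenInExtChartAt I I x p w = extChartAt I x ((extChartAt I x).symm w) := by
      rw [writtenInExtChartAt, h.extChartAt_eq]; rfl
    rw [this, (extChartAt I x).right_inv hw, id]
  · have : writtenInExtChartAt I I x p (extChartAt I x x)
        = extChartAt I x ((extChartAt I x).symm (extChartAt I x x)) := by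
      rw [writtenInExtChartAt, h.extChartAt_eq]; rfl
    rw [this, (extChartAt I x).right_inv (mem_extChartAt_target x), id]

/-- Serves to deduce smoothness of the pulled back metric from that of the original one: both sides
are derivatives of coordinate changes with the same germ. -/
lemma trivializationAt_symm_eq (h : IsPullbackCharted H p) [IsManifold I 1 M] [IsManifold I 1 N]
    (hp : Continuous p) (x₀ : N) : ∀ᶠ y in 𝓝 x₀, ∀ v : E,
      ((trivializationAt E (TangentSpace I : N → Type _) x₀).symm y v : E)
        = (trivializationAt E (TangentSpace I : M → Type _) (p x₀)).symm (p y) v := by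
  filter_upwards [h.coordChange_eventuallyEq (I := I) x₀, chart_source_mem_nhds H x₀,
    hp.continuousAt.preimage_mem_nhds (chart_source_mem_nhds H (p x₀))] with y hy hy1 hy2 v
  have e1 : (trivializationAt E (TangentSpace I : N → Type _) x₀).symm y v
      = (tangentBundleCore I N).coordChange (achart H x₀) (achart H y) y v :=
    VectorBundleCore.localTriv_symm_apply _ _ (by exact hy1) v
  have e2 : (trivializationAt E (TangentSpace I : M → Type _) (p x₀)).symm (p y) v
      = (tangentBundleCore I M).coordChange (achart H (p x₀)) (achart H (p y)) (p y) v :=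
    VectorBundleCore.localTriv_symm_apply _ _ (by exact hy2) v
  rw [e1, e2, tangentBundleCore_coordChange_achart, tangentBundleCore_coordChange_achart]
  have hy' := hy y
  have hval : extChartAt I x₀ y = extChartAt I (p x₀) (p y) := by rw [h.extChartAt_eq]; rfl
  have hmem : extChartAt I x₀ y ∈ range I := extChartAt_target_subset_range x₀
    ((extChartAt I x₀).map_source (by rw [extChartAt_source]; exact hy1))
  rw [Filter.EventuallyEq.fderivWithin_eq (f₁ := extChartAt I y ∘ (extChartAt I x₀).symm)
    (f := extChartAt I (p y) ∘ (extChartAt I (p x₀)).symm)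
    (eventually_nhdsWithin_of_eventually_nhds hy' |>.mp (by
      filter_upwards [self_mem_nhdsWithin] with w hw hw' using hw' hw))
    (hy'.self_of_nhds hmem), hval]

end IsPullbackCharted

end PullbackManifold

/-! ### Pulled back Riemannian metrics -/

namespace RiemMfd

open Topology Bundle

variable {d : ℕ}

/-- The inner product on the tangent spaces obtained by pulling back along `p`. -/
def pullbackInner (M : RiemMfd.{u} d) {N : Type u} [TopologicalSpace N]
    [ChartedSpace (EuclideanSpace ℝ (Fin d)) N] (p : N → M) (x : N) :
    TangentSpace (𝓡 d) x →L[ℝ] TangentSpace (𝓡 d) x →L[ℝ] ℝ :=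
  -- Both tangent spaces are by definition the model space, and the differential of `p` is its
  -- identity (`IsPullbackCharted.hasMFDerivAt`), so no differential appears.
  M.metric.inner (p x)

/-- The Riemannian metric obtained by pulling back along a local homeomorphism. -/
def pullbackMetric (M : RiemMfd.{u} d) {N : Type u} [TopologicalSpace N]
    [ChartedSpace (EuclideanSpace ℝ (Fin d)) N] [IsManifold (𝓡 d) ∞ N] {p : N → M}
    (hp : Continuous p) (h : IsPullbackCharted (EuclideanSpace ℝ (Fin d)) p) :
    Bundle.ContMDiffRiemannianMetric (𝓡 d) ∞ (EuclideanSpace ℝ (Fin d))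
      (fun x : N => TangentSpace (𝓡 d) x) where
  inner := M.pullbackInner p
  symm x := M.metric.symm (p x)
  pos x := M.metric.pos (p x)
  isVonNBounded x := M.metric.isVonNBounded (p x)
  contMDiff x₀ := by
    rw [contMDiffAt_section]
    have h1 := M.metric.contMDiff (p x₀)
    rw [contMDiffAt_section] at h1
    refine (h1.comp x₀ (h.contMDiff hp x₀)).congr_of_eventuallyEq ?_
    filter_upwards [h.trivializationAt_symm_eq (I := 𝓡 d) hp x₀,
      chart_source_mem_nhds (EuclideanSpace ℝ (Fin d)) x₀,
      hp.continuousAt.preimage_mem_nhds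
        (chart_source_mem_nhds (EuclideanSpace ℝ (Fin d)) (p x₀))] with y hy hy1 hy2
    simp only [Function.comp_apply, hom_trivializationAt_apply]
    ext v w
    rw [inCoordinates_apply_eq₂ hy1 hy1 (by simp), inCoordinates_apply_eq₂ hy2 hy2 (by simp)]
    have e1 := hy v
    have e2 := hy w
    set a := (trivializationAt (EuclideanSpace ℝ (Fin d)) (TangentSpace (𝓡 d) : N → Type _) x₀).symm
      y v
    set b := (trivializationAt (EuclideanSpace ℝ (Fin d)) (TangentSpace (𝓡 d) : N → Type _) x₀).symm
      y w
    rw [← e1, ← e2]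
    rfl

/-- The Riemannian manifold obtained by pulling back the smooth structure and the metric along a
local homeomorphism. -/
def pullback (M : RiemMfd.{u} d) {N : Type u} [TopologicalSpace N] [T2Space N]
    [SecondCountableTopology N] [ConnectedSpace N] {p : N → M} (hp : IsLocalHomeomorph p) :
    RiemMfd.{u} d :=
  letI := hp.pullbackChartedSpace (H := EuclideanSpace ℝ (Fin d))
  haveI : IsManifold (𝓡 d) ∞ N := hp.isPullbackCharted.isManifold
  { carrier := N
    metric := M.pullbackMetric hp.continuous hp.isPullbackCharted }

variable {X Y Z : RiemMfd.{u} d}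

lemma IsLocalIsometry.comp {g : Y → Z} {f : X → Y} (hg : IsLocalIsometry g)
    (hf : IsLocalIsometry f) : IsLocalIsometry (g ∘ f) := by
  refine ⟨hg.contMDiff.comp hf.contMDiff, fun x v w => ?_⟩
  rw [mfderiv_comp x ((hg.contMDiff (f x)).mdifferentiableAt (by simp))
    ((hf.contMDiff x).mdifferentiableAt (by simp))]
  exact (hg.inner_mfderiv (f x) _ _).trans (hf.inner_mfderiv x v w)

section Pullback

variable (M : RiemMfd.{u} d) {N : Type u} [TopologicalSpace N] [T2Space N]
  [SecondCountableTopology N] [ConnectedSpace N] {p : N → M} (hp : IsLocalHomeomorph p)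

/-- The projection of the pulled back manifold. -/
def pullbackProj : M.pullback hp → M := p

lemma pullback_isPullbackCharted :
    IsPullbackCharted (EuclideanSpace ℝ (Fin d)) (M.pullbackProj hp) :=
  hp.isPullbackCharted

lemma isLocalIsometry_pullback : IsLocalIsometry (M.pullbackProj hp) := by
  refine ⟨(M.pullback_isPullbackCharted hp).contMDiff hp.continuous, fun x v w => ?_⟩
  have h := ((M.pullback_isPullbackCharted hp).hasMFDerivAt (I := 𝓡 d) hp.continuous x).mfderiv
  rw [h]
  rfl

/-- A continuous map to the pulled back manifold is a local isometry if its composition with the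
projection is. -/
lemma isLocalIsometry_of_comp_pullback {f : X → M.pullback hp} (hf : Continuous f)
    (hpf : IsLocalIsometry (M.pullbackProj hp ∘ f)) : IsLocalIsometry f := by
  have hs : ContMDiff (𝓡 d) (𝓡 d) ∞ f := fun x =>
    (M.pullback_isPullbackCharted hp).contMDiffAt_of_comp hf.continuousAt (hpf.contMDiff x)
  have hpi := M.isLocalIsometry_pullback hp
  refine ⟨hs, fun x v w => ?_⟩
  have h1 := hpf.inner_mfderiv x v w
  rw [mfderiv_comp x ((hpi.contMDiff (f x)).mdifferentiableAt (by simp))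
    ((hs x).mdifferentiableAt (by simp))] at h1
  exact (hpi.inner_mfderiv (f x) _ _).symm.trans h1

end Pullback

end RiemMfd

/-! ### Cocycles evaluated on paths; homotopy invariance -/

section SimplyConnected

lemma simplexFace_apply_succAbove {n : ℕ} (i : Fin (n + 2)) (t : stdSimplex ℝ (Fin (n + 1)))
    (j : Fin (n + 1)) : simplexFace i t (i.succAbove j) = t j := by
  change FunOnFinite.linearMap ℝ ℝ i.succAbove t (i.succAbove j) = t j
  rw [FunOnFinite.linearMap_apply_apply]
  simp [Finset.filter_eq', (Fin.succAbove_right_injective (p := i)).eq_iff]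

lemma simplexFace_apply_self {n : ℕ} (i : Fin (n + 2)) (t : stdSimplex ℝ (Fin (n + 1))) :
    simplexFace i t i = 0 := by
  change FunOnFinite.linearMap ℝ ℝ i.succAbove t i = 0
  rw [FunOnFinite.linearMap_apply_apply]
  simp [Fin.succAbove_ne]

lemma simplexFace_zero (t : stdSimplex ℝ (Fin 2)) :
    simplexFace 0 t 0 = 0 ∧ simplexFace 0 t 1 = t 0 ∧ simplexFace 0 t 2 = t 1 :=
  ⟨simplexFace_apply_self 0 t, simplexFace_apply_succAbove 0 t 0, simplexFace_apply_succAbove 0 t 1⟩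

lemma simplexFace_one (t : stdSimplex ℝ (Fin 2)) :
    simplexFace 1 t 0 = t 0 ∧ simplexFace 1 t 1 = 0 ∧ simplexFace 1 t 2 = t 1 :=
  ⟨simplexFace_apply_succAbove 1 t 0, simplexFace_apply_self 1 t, simplexFace_apply_succAbove 1 t 1⟩

lemma simplexFace_two (t : stdSimplex ℝ (Fin 2)) :
    simplexFace 2 t 0 = t 0 ∧ simplexFace 2 t 1 = t 1 ∧ simplexFace 2 t 2 = 0 :=
  ⟨simplexFace_apply_succAbove 2 t 0, simplexFace_apply_succAbove 2 t 1, simplexFace_apply_self 2 t⟩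

lemma stdSimplex_continuous_apply {n : ℕ} (i : Fin (n + 1)) :
    Continuous fun t : stdSimplex ℝ (Fin (n + 1)) => t i :=
  (continuous_apply i).comp continuous_subtype_val

variable {X : Type*} [TopologicalSpace X]

/-- The singular simplex obtained from a map defined on the line, through a continuous function
on the simplex. -/
def Path.simplex {n : ℕ} {x y : X} (γ : Path x y) (a : C(stdSimplex ℝ (Fin (n + 1)), ℝ)) :
    Sing n X :=
  ⟨fun t => γ.extend (a t), γ.continuous_extend.comp a.continuous⟩

/-- The coordinate functions on the standard simplex. -/
def simplexCoord {n : ℕ} (i : Fin (n + 1)) : C(stdSimplex ℝ (Fin (n + 1)), ℝ) :=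
  ⟨fun t => t i, stdSimplex_continuous_apply i⟩

/-- The singular `1`-simplex given by a path. -/
def Path.toSing {x y : X} (γ : Path x y) : Sing 1 X := γ.simplex (simplexCoord 1)

lemma stdSimplex_two_add (t : stdSimplex ℝ (Fin 2)) : t 0 + t 1 = 1 := by
  exact stdSimplex.add_eq_one t

lemma Path.toSing_vertex_zero {x y : X} (γ : Path x y) : γ.toSing (simplexVertex 0) = x := by
  simp [Path.toSing, Path.simplex, simplexCoord]

lemma Path.toSing_vertex_one {x y : X} (γ : Path x y) : γ.toSing (simplexVertex 1) = y := by
  simp [Path.toSing, Path.simplex, simplexCoord]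

/-- The standard parametrization of the `1`-simplex. -/
def simplexLine : Path (simplexVertex (n := 1) 0) (simplexVertex 1) where
  toFun s := ⟨![1 - s.1, s.1], by
    intro i; fin_cases i <;> simp [s.2.1, s.2.2], by simp⟩
  continuous_toFun := by
    refine Continuous.subtype_mk (continuous_pi fun i => ?_) _
    fin_cases i <;> simp <;> fun_prop
  source' := by ext i; fin_cases i <;> simp [DFunLike.coe]
  target' := by ext i; fin_cases i <;> simp [DFunLike.coe]

/-- The path given by a singular `1`-simplex. -/
def Sing.toPath (σ : Sing 1 X) : Path (σ (simplexVertex 0)) (σ (simplexVertex 1)) :=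
  simplexLine.map σ.continuous

lemma Sing.toPath_toSing (σ : Sing 1 X) : (Sing.toPath σ).toSing = σ := by
  ext t
  have ht := stdSimplex_two_add t
  have h1 : t 1 ∈ unitInterval := ⟨stdSimplex.zero_le t 1, stdSimplex.le_one t 1⟩
  change (Sing.toPath σ).extend (t 1) = σ t
  rw [Path.extend_apply _ h1]
  change σ (simplexLine ⟨t 1, h1⟩) = σ t
  congr 1
  ext i
  fin_cases i
  · change 1 - t 1 = t 0
    linarith
  · rfl

variable {T : Type*} [AddCommGroup T] {c : Sing 1 X → T}

lemma IsSingCocycle.const (hc : IsSingCocycle c) (x : X) : c (ContinuousMap.const _ x) = 0 := by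
  have h := hc (ContinuousMap.const _ x)
  simpa only [ContinuousMap.const_comp, left_eq_add] using h

lemma IsSingCocycle.trans (hc : IsSingCocycle c) {x y z : X} (p : Path x y) (q : Path y z) :
    c (p.trans q).toSing = c p.toSing + c q.toSing := by
  -- The parameter is the affine function with values 0, 1/2, 1 at the vertices, so faces 2, 0, 1
  -- are `p`, `q` and the concatenation.
  have h := hc ((p.trans q).simplex
    ⟨fun t => t 1 / 2 + t 2, ((stdSimplex_continuous_apply 1).div_const 2).add
      (stdSimplex_continuous_apply 2)⟩)
  have key : ∀ s : ℝ, (p.trans q).extend s = if s ≤ 1 / 2 then p.extend (2 * s)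
      else q.extend (2 * s - 1) := by
    intro s
    by_cases hs : s ∈ unitInterval
    · rw [Path.extend_apply _ hs, Path.trans_apply]
      split_ifs with h1
      · rw [Path.extend_apply]
      · rw [Path.extend_apply]
    · rw [Set.mem_Icc, not_and_or, not_le, not_le] at hs
      rcases hs with hs | hs
      · rw [Path.extend_of_le_zero _ hs.le, if_pos (by linarith),
          Path.extend_of_le_zero _ (by linarith)]
      · rw [Path.extend_of_one_le _ hs.le, if_neg (by linarith),
          Path.extend_of_one_le _ (by linarith)]
  convert h using 2
  · ext t
    change (p.trans q).extend (t 1)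
      = (p.trans q).extend (simplexFace 1 t 1 / 2 + simplexFace 1 t 2)
    rw [(simplexFace_one t).2.1, (simplexFace_one t).2.2]
    simp
  · congr 1
    ext t
    change p.extend (t 1) = (p.trans q).extend (simplexFace 2 t 1 / 2 + simplexFace 2 t 2)
    rw [(simplexFace_two t).2.1, (simplexFace_two t).2.2, key, if_pos (by linarith [stdSimplex.le_one t 1])]
    congr 1; ring
  · congr 1
    ext t
    change q.extend (t 1) = (p.trans q).extend (simplexFace 0 t 1 / 2 + simplexFace 0 t 2)
    have ht := stdSimplex_two_add t
    rw [(simplexFace_zero t).2.1, (simplexFace_zero t).2.2, key]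
    split_ifs with h1
    · have h2 := stdSimplex.zero_le t 1
      have h0 : t 1 = 0 := by linarith
      have h3 : t 0 = 1 := by linarith
      rw [h0, h3]
      simp
    · congr 1; linarith

/-- The square of the homotopy is cut along its diagonal into two triangles. They share face 1; the
other faces are `p`, `q` and the two constant sides, on which a cocycle vanishes. -/
lemma IsSingCocycle.homotopy (hc : IsSingCocycle c) {x y : X} {p q : Path x y}
    (H : p.Homotopy q) : c p.toSing = c q.toSing := by
  -- Clamping both coordinates extends the homotopy to the plane, which spares membership proofs.
  let K : C(ℝ × ℝ, X) := ⟨fun u => H (Set.projIcc 0 1 zero_le_one u.1,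
    Set.projIcc 0 1 zero_le_one u.2), by fun_prop⟩
  have hK0 : ∀ s, K (0, s) = p.extend s := fun s => by
    change H (Set.projIcc 0 1 zero_le_one 0, _) = _
    rw [Set.projIcc_left]; exact H.apply_zero _
  have hK1 : ∀ s, K (1, s) = q.extend s := fun s => by
    change H (Set.projIcc 0 1 zero_le_one 1, _) = _
    rw [Set.projIcc_right]; exact H.apply_one _
  have hKx : ∀ s, K (s, 0) = x := fun s => by
    change H (_, Set.projIcc 0 1 zero_le_one 0) = _
    rw [Set.projIcc_left]; exact H.source _
  have hKy : ∀ s, K (s, 1) = y := fun s => by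
    change H (_, Set.projIcc 0 1 zero_le_one 1) = _
    rw [Set.projIcc_right]; exact H.target _
  have hA := hc (K.comp ((simplexCoord 2).prodMk (simplexCoord 1 + simplexCoord 2)))
  have hB := hc (K.comp ((simplexCoord 1 + simplexCoord 2).prodMk (simplexCoord 2)))
  have eA2 : ((K.comp ((simplexCoord 2).prodMk (simplexCoord 1 + simplexCoord 2))).comp
      (simplexFace 2)) = p.toSing := by
    ext t
    change K (simplexFace 2 t 2, simplexFace 2 t 1 + simplexFace 2 t 2) = p.extend (t 1)
    rw [(simplexFace_two t).2.1, (simplexFace_two t).2.2, add_zero, hK0]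
  have eA0 : ((K.comp ((simplexCoord 2).prodMk (simplexCoord 1 + simplexCoord 2))).comp
      (simplexFace (n := 1) 0)) = ContinuousMap.const _ y := by
    ext t
    change K (simplexFace 0 t 2, simplexFace 0 t 1 + simplexFace 0 t 2) = y
    rw [(simplexFace_zero t).2.1, (simplexFace_zero t).2.2, stdSimplex_two_add, hKy]
  have eB2 : ((K.comp ((simplexCoord 1 + simplexCoord 2).prodMk (simplexCoord 2))).comp
      (simplexFace (n := 1) 2)) = ContinuousMap.const _ x := by
    ext t
    change K (simplexFace 2 t 1 + simplexFace 2 t 2, simplexFace 2 t 2) = x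
    rw [(simplexFace_two t).2.2, hKx]
  have eB0 : ((K.comp ((simplexCoord 1 + simplexCoord 2).prodMk (simplexCoord 2))).comp
      (simplexFace 0)) = q.toSing := by
    ext t
    change K (simplexFace 0 t 1 + simplexFace 0 t 2, simplexFace 0 t 2) = q.extend (t 1)
    rw [(simplexFace_zero t).2.1, (simplexFace_zero t).2.2, stdSimplex_two_add, hK1]
  have e1 : ((K.comp ((simplexCoord 2).prodMk (simplexCoord 1 + simplexCoord 2))).comp
      (simplexFace (n := 1) 1)) = ((K.comp ((simplexCoord 1 + simplexCoord 2).prodMk (simplexCoord 2))).comp (simplexFace 1)) := by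
    ext t
    change K (simplexFace 1 t 2, simplexFace 1 t 1 + simplexFace 1 t 2)
      = K (simplexFace 1 t 1 + simplexFace 1 t 2, simplexFace 1 t 2)
    rw [(simplexFace_one t).2.1, zero_add]
  rw [eA2, eA0, hc.const, add_zero] at hA
  rw [eB2, eB0, hc.const, zero_add, ← e1, hA] at hB
  exact hB

/-- On a simply connected space, every singular `1`-cocycle is a coboundary. -/
lemma IsSingCocycle.exists_primitive [SimplyConnectedSpace X] (hc : IsSingCocycle c) :
    ∃ f : X → T, ∀ σ, c σ = f (σ (simplexVertex 1)) - f (σ (simplexVertex 0)) := by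
  obtain ⟨x₀⟩ : Nonempty X := inferInstance
  refine ⟨fun x => c (PathConnectedSpace.somePath x₀ x).toSing, fun σ => ?_⟩
  obtain ⟨H⟩ := SimplyConnectedSpace.paths_homotopic
    ((PathConnectedSpace.somePath x₀ (σ (simplexVertex 0))).trans (Sing.toPath σ))
    (PathConnectedSpace.somePath x₀ (σ (simplexVertex 1)))
  have h := hc.homotopy H
  rw [hc.trans, Sing.toPath_toSing] at h
  exact eq_sub_of_add_eq' h

lemma eq_of_forall_sing [PathConnectedSpace X] {S : Type*} {F : X → S}
    (h : ∀ σ : Sing 1 X, F (σ (simplexVertex 0)) = F (σ (simplexVertex 1))) (x y : X) :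
    F x = F y := by
  have := h (PathConnectedSpace.somePath x y).toSing
  rwa [Path.toSing_vertex_zero, Path.toSing_vertex_one] at this

lemma IsSingCocycle.comp {Y : Type*} [TopologicalSpace Y] (hc : IsSingCocycle c) (f : C(Y, X)) :
    IsSingCocycle fun σ => c (f.comp σ) := fun τ => hc (f.comp τ)

/-- With simple connectedness, this allows singular simplices to be lifted through coverings. -/
instance stdSimplex.instLocallyPathConnectedSpace {n : ℕ} :
    LocallyPathConnectedSpace (stdSimplex ℝ (Fin (n + 1))) :=
  (convex_stdSimplex ℝ (Fin (n + 1))).locallyPathConnectedSpace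

instance stdSimplex.instSimplyConnectedSpace {n : ℕ} :
    SimplyConnectedSpace (stdSimplex ℝ (Fin (n + 1))) :=
  have := (convex_stdSimplex ℝ (Fin (n + 1))).contractibleSpace ⟨_, (simplexVertex 0).2⟩
  inferInstance

end SimplyConnected

/-! ### The induced module as functions on cosets -/

section PermutationModule

variable (ℓ : ℕ) {G : Type*} [Group G] (H : Subgroup G)

/-- The permutation module of functions on the cosets. -/
def cosetFunRep : Representation (ZMod ℓ) G (G ⧸ H → ZMod ℓ) where
  toFun g := LinearMap.funLeft (ZMod ℓ) (ZMod ℓ) (g⁻¹ • ·)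
  map_one' := by ext; simp [LinearMap.funLeft_apply]
  map_mul' g h := by ext; simp [LinearMap.funLeft_apply, mul_smul]

lemma cosetFunRep_apply (g : G) (v : G ⧸ H → ZMod ℓ) (c : G ⧸ H) :
    cosetFunRep ℓ H g v c = v (g⁻¹ • c) := rfl

/-- The standard basis of the induced module. -/
def indTrivialBasis : Module.Basis (G ⧸ H) (ZMod ℓ) (ZMod ℓ ⊗[ℤ] MonoidAlgebra ℤ (G ⧸ H)) :=
  Module.Basis.baseChange (ZMod ℓ) ⟨MonoidAlgebra.coeffLinearEquiv ℤ⟩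

lemma indTrivialMod_basis (g : G) (c : G ⧸ H) :
    indTrivialMod ℓ H g (indTrivialBasis ℓ H c) = indTrivialBasis ℓ H (g • c) := by
  have h : ∀ c : G ⧸ H, indTrivialBasis ℓ H c
      = (1 : ZMod ℓ) ⊗ₜ[ℤ] (MonoidAlgebra.single c (1 : ℤ)) := fun c => by
    rw [indTrivialBasis, Module.Basis.baseChange_apply]
    rfl
  rw [h, h]
  change (Representation.ofMulAction ℤ G (G ⧸ H) g).baseChange (ZMod ℓ) _ = _
  rw [LinearMap.baseChange_tmul, Representation.ofMulAction_single]

variable [Finite (G ⧸ H)]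

/-- The induced module is the module of functions on the cosets. -/
def indTrivialEquiv :
    (ZMod ℓ ⊗[ℤ] MonoidAlgebra ℤ (G ⧸ H)) ≃ₗ[ZMod ℓ] (G ⧸ H → ZMod ℓ) :=
  letI := Fintype.ofFinite (G ⧸ H)
  (indTrivialBasis ℓ H).equivFun

lemma indTrivialEquiv_apply (g : G) (x : ZMod ℓ ⊗[ℤ] MonoidAlgebra ℤ (G ⧸ H)) :
    indTrivialEquiv ℓ H (indTrivialMod ℓ H g x) = cosetFunRep ℓ H g (indTrivialEquiv ℓ H x) := by
  classical
  let _ := Fintype.ofFinite (G ⧸ H)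
  suffices h : (indTrivialEquiv ℓ H).toLinearMap ∘ₗ indTrivialMod ℓ H g
      = cosetFunRep ℓ H g ∘ₗ (indTrivialEquiv ℓ H).toLinearMap from LinearMap.congr_fun h x
  refine (indTrivialBasis ℓ H).ext fun c => ?_
  simp only [LinearMap.comp_apply, LinearEquiv.coe_coe]
  rw [indTrivialMod_basis]
  ext c'
  rw [cosetFunRep_apply]
  simp only [indTrivialEquiv, Module.Basis.equivFun_self]
  simp only [eq_inv_smul_iff]

/-- The induced module is a quotient of a module if and only if the module of functions on the
cosets is. -/
lemma isQuotientModule_indTrivialMod_iff {V : Type*} [AddCommGroup V] [Module (ZMod ℓ) V]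
    (ρ : Representation (ZMod ℓ) G V) :
    IsQuotientModule ρ (indTrivialMod ℓ H) ↔
      ∃ φ : V →ₗ[ZMod ℓ] (G ⧸ H → ZMod ℓ), Function.Surjective φ ∧
        ∀ g v, φ (ρ g v) = cosetFunRep ℓ H g (φ v) := by
  constructor
  · rintro ⟨φ, hφ⟩
    refine ⟨(indTrivialEquiv ℓ H).toLinearMap ∘ₗ φ.toLinearMap,
      (indTrivialEquiv ℓ H).surjective.comp hφ, fun g v => ?_⟩
    have := LinearMap.congr_fun (φ.isIntertwining' g) v
    simp only [LinearMap.comp_apply, LinearEquiv.coe_coe] at this ⊢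
    rw [this, indTrivialEquiv_apply]
  · rintro ⟨φ, hφ, h⟩
    refine ⟨((indTrivialEquiv ℓ H).symm.toLinearMap ∘ₗ φ).intertwiningMap_of_isIntertwiningMap _ _
      fun g v => ?_, (indTrivialEquiv ℓ H).symm.surjective.comp hφ⟩
    simp only [LinearMap.comp_apply, LinearEquiv.coe_coe]
    rw [LinearEquiv.symm_apply_eq, indTrivialEquiv_apply, h, LinearEquiv.apply_symm_apply]

end PermutationModule

/-! ### From coverings to homology -/

section CoveringCocycle

variable (ℓ : ℕ) {X E : Type u} [TopologicalSpace X] [TopologicalSpace E] {V : Type*}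
  [AddCommGroup V] [Module (ZMod ℓ) V] [AddAction V E] {p : E → X}

lemma IsCoveringMap.exists_sing_lift (cov : IsCoveringMap p) (hp : Function.Surjective p) {n : ℕ}
    (σ : Sing n X) : ∃ σ' : Sing n E, ∀ t, p (σ' t) = σ t := by
  obtain ⟨e, he⟩ := hp (σ (simplexVertex 0))
  obtain ⟨σ', ⟨-, h⟩, -⟩ := cov.existsUnique_continuousMap_lifts σ (simplexVertex 0) e he
  exact ⟨σ', congrFun h⟩

/-- A connected covering with group an `𝔽_ℓ`-vector space `V` induces a surjection from the first
homology of the base to `V`, natural in the covering. -/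
lemma IsCoveringMap.exists_homology_surjection [PathConnectedSpace E] [ContinuousConstVAdd V E]
    (cov : IsCoveringMap p) (hp : Function.Surjective p)
    (free : ∀ (v : V) (e : E), v +ᵥ e = e → v = 0)
    (fibre : ∀ e e' : E, p e = p e' ↔ ∃ v : V, v +ᵥ e = e') :
    ∃ φ : firstHomology ℓ X →ₗ[ZMod ℓ] V, Function.Surjective φ ∧
      ∀ (f : C(X, X)) (F : C(E, E)) (A : V →ₗ[ZMod ℓ] V), (∀ e, p (F e) = f (p e)) →
        (∀ (v : V) (e : E), F (v +ᵥ e) = A v +ᵥ F e) →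
        ∀ s, φ (firstHomologyMap ℓ f s) = A (φ s) := by
  have hs := Function.rightInverse_surjInv hp
  set s : X → E := Function.surjInv hp
  -- `θ e` is the displacement of `e` from the section `s`, which need not be continuous.
  have hθ : ∀ e : E, ∃ v : V, v +ᵥ s (p e) = e := fun e => (fibre _ _).1 (hs (p e))
  choose θ hθ using hθ
  have hpv : ∀ (v : V) (e : E), p (v +ᵥ e) = p e := fun v e => ((fibre _ _).2 ⟨v, rfl⟩).symm
  have inj : ∀ (v w : V) (e : E), v +ᵥ e = w +ᵥ e → v = w := fun v w e h => by
    refine sub_eq_zero.1 (free (v - w) e ?_)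
    rw [sub_eq_neg_add, add_vadd, h, neg_vadd_vadd]
  have θadd : ∀ (v : V) (e : E), θ (v +ᵥ e) = v + θ e := fun v e => by
    refine inj _ _ (s (p e)) ?_
    rw [add_vadd, hθ, ← hpv v e, hθ]
  choose lift hlift using fun σ : Sing 1 X => cov.exists_sing_lift hp σ
  let c : Sing 1 X → V := fun σ =>
    θ (lift σ (simplexVertex 1)) - θ (lift σ (simplexVertex 0))
  -- Two lifts differ by a translation, which shifts `θ` equally at both ends.
  have hc : ∀ (σ : Sing 1 X) (σ' : Sing 1 E), (∀ t, p (σ' t) = σ t) →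
      c σ = θ (σ' (simplexVertex 1)) - θ (σ' (simplexVertex 0)) := fun σ σ' h => by
    obtain ⟨v, hv⟩ := (fibre (lift σ (simplexVertex 0)) (σ' (simplexVertex 0))).1
      (by rw [hlift, h])
    have : (fun t => v +ᵥ lift σ t) = σ' :=
      cov.eq_of_comp_eq ((continuous_const_vadd v).comp (lift σ).continuous) σ'.continuous
        (funext fun t => by simp [hpv, hlift, h]) (simplexVertex 0) hv
    rw [← this]
    simp only [θadd, c]
    abel
  have hcoc : IsSingCocycle c := fun τ => by
    obtain ⟨τ', h⟩ := cov.exists_sing_lift hp τ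
    have key : ∀ i, c (τ.comp (simplexFace i)) = θ (τ' (simplexVertex (i.succAbove 1)))
        - θ (τ' (simplexVertex (i.succAbove 0))) := fun i => by
      rw [hc _ (τ'.comp (simplexFace i)) fun t => h _]
      simp only [ContinuousMap.comp_apply, simplexFace_vertex]
    rw [key, key, key]
    simp [Fin.succAbove]
  obtain ⟨φ, hφ⟩ := hcoc.exists_represents ℓ
  refine ⟨φ, fun v => ?_, fun f F A hF hA z => ?_⟩
  -- A path from `e` to `v +ᵥ e` projects to a loop on which the cocycle takes the value `v`.
  · obtain ⟨e⟩ : Nonempty E := inferInstance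
    let γ := (PathConnectedSpace.somePath e (v +ᵥ e)).toSing
    let σ : Sing 1 X := ⟨fun t => p (γ t), cov.continuous.comp γ.continuous⟩
    obtain ⟨z, hz⟩ := exists_loopClass ℓ (T := V) σ (by
      change p (γ _) = p (γ _)
      simp only [γ, Path.toSing_vertex_zero, Path.toSing_vertex_one, hpv])
    refine ⟨z, ?_⟩
    rw [hz c φ hφ, hc σ γ fun t => rfl]
    simp only [γ, Path.toSing_vertex_zero, Path.toSing_vertex_one, θadd, add_sub_cancel_right]
  -- The function `θ (F e) - A (θ e)` is invariant under translations; descended to `X`, it has as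
  -- coboundary the difference of the two cocycles.
  · have h := (hφ.comp_map ℓ f).ext ℓ (hφ.map A) (fun x => θ (F (s x)) - A (θ (s x))) fun σ => by
      have hb : ∀ e, θ (F (s (p e))) - A (θ (s (p e))) = θ (F e) - A (θ e) := fun e => by
        conv_rhs => rw [← hθ e, hA, θadd, θadd, map_add]
        abel
      have h1 := hc (f.comp σ) (F.comp (lift σ)) fun t => by
        simp only [ContinuousMap.comp_apply, hF, hlift]
      have h2 := hb (lift σ (simplexVertex 1))
      have h3 := hb (lift σ (simplexVertex 0))
      rw [hlift] at h2 h3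
      rw [h1, h2, h3]
      simp only [ContinuousMap.comp_apply, c, map_sub]
      abel
    exact LinearMap.congr_fun h z

end CoveringCocycle

/-! ### The wreath product and its base -/

section WreathElements

variable (ℓ : ℕ) {G : Type*} [Group G] (H : Subgroup G)

/-- The elements of the base of the wreath product, additively. -/
def wreathVec (v : G ⧸ H → ZMod ℓ) : WreathProduct ℓ H :=
  SemidirectProduct.inl fun c => Multiplicative.ofAdd (v c)

lemma wreathVec_zero : wreathVec ℓ H 0 = 1 := map_one _

lemma wreathVec_add (v w : G ⧸ H → ZMod ℓ) :
    wreathVec ℓ H (v + w) = wreathVec ℓ H v * wreathVec ℓ H w :=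
  map_mul SemidirectProduct.inl _ _

lemma wreathVec_mem (v : G ⧸ H → ZMod ℓ) : wreathVec ℓ H v ∈ WreathProduct.base ℓ H :=
  ⟨_, rfl⟩

lemma exists_wreathVec {k : WreathProduct ℓ H} (hk : k ∈ WreathProduct.base ℓ H) :
    ∃ v, wreathVec ℓ H v = k := by
  obtain ⟨v, rfl⟩ := hk
  exact ⟨fun c => (v c).toAdd, rfl⟩

lemma wreathVec_injective : Function.Injective (wreathVec ℓ H) :=
  fun _ _ h => SemidirectProduct.inl_injective (N := G ⧸ H → Multiplicative (ZMod ℓ)) h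

/-- This is where the induced module comes from: conjugation by G on the base is the permutation
action on functions on cosets. -/
lemma inr_mul_wreathVec (g : G) (v : G ⧸ H → ZMod ℓ) :
    (SemidirectProduct.inr g : WreathProduct ℓ H) * wreathVec ℓ H v
      = wreathVec ℓ H (cosetFunRep ℓ H g v) * SemidirectProduct.inr g := by
  have h := SemidirectProduct.inl_aut (φ := mulAutArrow (G := G)) g
    (fun c => Multiplicative.ofAdd (v c) : G ⧸ H → Multiplicative (ZMod ℓ))
  have h' : wreathVec ℓ H (cosetFunRep ℓ H g v) = SemidirectProduct.inr g * wreathVec ℓ H v *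
    SemidirectProduct.inr g⁻¹ := h
  rw [h', map_inv, inv_mul_cancel_right]

end WreathElements

/-! ### (A) implies (B) -/

namespace RiemMfd

variable {d : ℕ}

instance (X : RiemMfd.{u} d) : LocallyPathConnectedSpace X :=
  ChartedSpace.locallyPathConnectedSpace (EuclideanSpace ℝ (Fin d)) X

instance (X : RiemMfd.{u} d) : PathConnectedSpace X :=
  pathConnectedSpace_iff_connectedSpace.2 inferInstance

lemma ActsByIsometries.continuousConstSMul {K : Type*} [Group K] {X : RiemMfd.{u} d}
    [MulAction K X] (h : ActsByIsometries K X) : ContinuousConstSMul K X :=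
  ⟨fun k => (h k).contMDiff.continuous⟩

end RiemMfd

/-- A wreath product covering gives the induced module as a quotient of the homology. -/
theorem ExtendsToWreathCover.isQuotientModule {d : ℕ} {M₀ : DevelopableOrbifold.{u} d}
    {M M₁ : RiemMfd.{u} d} {G : Type*} [Group G] [Finite G] [MulAction G M]
    [ContinuousConstSMul G M] {H : Subgroup G} {q : M → M₀.Space} {q₁ : M → M₁} {ℓ : ℕ}
    (h : ExtendsToWreathCover ℓ H q q₁) :
    IsQuotientModule (firstHomologyRep ℓ G M) (indTrivialMod ℓ H) := by
  obtain ⟨M', _, π, -, hπ, hbase, -, hW⟩ := h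
  rw [isQuotientModule_indTrivialMod_iff]
  let _ : AddAction (G ⧸ H → ZMod ℓ) M' :=
    { vadd v x := wreathVec ℓ H v • x
      zero_vadd x := by
        change wreathVec ℓ H 0 • x = x
        rw [wreathVec_zero, one_smul]
      add_vadd v w x := by
        change wreathVec ℓ H (v + w) • x = wreathVec ℓ H v • wreathVec ℓ H w • x
        rw [wreathVec_add, mul_smul] }
  have hv : ∀ (v : G ⧸ H → ZMod ℓ) (x : M'), v +ᵥ x = wreathVec ℓ H v • x := fun _ _ => rfl
  have hcont := hW.actsByIsometries.continuousConstSMul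
  have _ : ContinuousConstVAdd (G ⧸ H → ZMod ℓ) M' :=
    ⟨fun v => continuous_const_smul (wreathVec ℓ H v)⟩
  obtain ⟨φ, hφ, hnat⟩ := hbase.isRiemannianCovering.isCoveringMap.exists_homology_surjection ℓ
    (V := G ⧸ H → ZMod ℓ) hbase.isRiemannianCovering.surjective
    (fun v e he => by
      have := hbase.free ⟨wreathVec ℓ H v, wreathVec_mem ℓ H v⟩ e he
      exact wreathVec_injective ℓ H ((congrArg Subtype.val this).trans (wreathVec_zero ℓ H).symm))
    (fun e e' => by
      rw [hbase.fibre]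
      constructor
      · rintro ⟨⟨k, hk⟩, rfl⟩
        obtain ⟨v, rfl⟩ := exists_wreathVec ℓ H hk
        exact ⟨v, rfl⟩
      · rintro ⟨v, rfl⟩
        exact ⟨⟨wreathVec ℓ H v, wreathVec_mem ℓ H v⟩, rfl⟩)
  refine ⟨φ, hφ, fun g s => ?_⟩
  rw [firstHomologyRep_apply]
  refine hnat _ ⟨fun x => (SemidirectProduct.inr g : WreathProduct ℓ H) • x,
    continuous_const_smul _⟩ _ (fun e => ?_) (fun v e => ?_) s
  · change π ((SemidirectProduct.inr g : WreathProduct ℓ H) • e) = g • π e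
    rw [hπ, SemidirectProduct.right_inr]
  · change (SemidirectProduct.inr g : WreathProduct ℓ H) • (wreathVec ℓ H v • e)
      = wreathVec ℓ H (cosetFunRep ℓ H g v) • ((SemidirectProduct.inr g : WreathProduct ℓ H) • e)
    rw [← mul_smul, ← mul_smul, inr_mul_wreathVec]

/-! ### From homology to homomorphisms on the covering group -/

/-- A surjective homomorphism from the first homology of `M` gives a surjective homomorphism from
the group of the universal covering of `M`, naturally in maps of the covering. -/
theorem exists_deck_hom (ℓ : ℕ) [Fact ℓ.Prime] {X M : Type u} [TopologicalSpace X]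
    [TopologicalSpace M] [SimplyConnectedSpace X] {π : X → M} (cov : IsCoveringMap π)
    (hπ : Function.Surjective π) {Γ : Type*} [Group Γ] [MulAction Γ X] [ContinuousConstSMul Γ X]
    (hfib : ∀ x y, π x = π y ↔ ∃ γ : Γ, γ • x = y) {V : Type*} [AddCommGroup V]
    [Module (ZMod ℓ) V] {φ : firstHomology ℓ M →ₗ[ZMod ℓ] V} (hφ : Function.Surjective φ) :
    ∃ ψ : Γ →* Multiplicative V, Function.Surjective ψ ∧
      ∀ (g : C(M, M)) (A : V →ₗ[ZMod ℓ] V), (∀ s, φ (firstHomologyMap ℓ g s) = A (φ s)) →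
      ∀ F : C(X, X), (∀ x, π (F x) = g (π x)) →
      ∀ γ γ' : Γ, (∀ x, F (γ • x) = γ' • F x) → (ψ γ').toAdd = A (ψ γ).toAdd := by
  obtain ⟨c, hc⟩ := exists_represents ℓ φ
  let π' : C(X, M) := ⟨π, cov.continuous⟩
  obtain ⟨f, hf⟩ := ((hc.isSingCocycle ℓ).comp π').exists_primitive
  have hΓ : ∀ (γ : Γ) (x : X), π (γ • x) = π x := fun γ x => ((hfib _ _).2 ⟨γ, rfl⟩).symm
  -- The pulled back cocycle is invariant under Γ, so `f ∘ γ` and `f` are primitives of the same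
  -- cocycle and differ by a constant.
  have hconst : ∀ (γ : Γ) (x y : X), f (γ • x) - f x = f (γ • y) - f y := by
    intro γ x y
    refine eq_of_forall_sing (F := fun x => f (γ • x) - f x) (fun σ => ?_) x y
    have h1 := hf σ
    have h2 := hf ((⟨fun x => γ • x, continuous_const_smul γ⟩ : C(X, X)).comp σ)
    have h3 : π'.comp ((⟨fun x => γ • x, continuous_const_smul γ⟩ : C(X, X)).comp σ)
        = π'.comp σ := by
      ext t
      exact hΓ γ (σ t)
    rw [h3, h1] at h2
    simp only [ContinuousMap.comp_apply, ContinuousMap.coe_mk] at h2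
    rw [sub_eq_sub_iff_sub_eq_sub, ← neg_inj, neg_sub, neg_sub]
    exact h2.symm
  have x₀ : X := Classical.arbitrary X
  let ψ : Γ →* Multiplicative V :=
    { toFun γ := .ofAdd (f (γ • x₀) - f x₀)
      map_one' := by rw [one_smul, sub_self]; rfl
      map_mul' a b := by
        rw [← ofAdd_add, hconst a x₀ (b • x₀), mul_smul, sub_add_sub_cancel] }
  have hψ : ∀ (γ : Γ) (x : X), f (γ • x) = (ψ γ).toAdd + f x := fun γ x =>
    sub_eq_iff_eq_add.1 (hconst γ x x₀)
  refine ⟨ψ, ?_, fun g A hA F hF γ γ' hγ => ?_⟩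
  -- The image of `ψ` is automatically a subspace. Modulo it, `f` descends to `M`, so the cocycle
  -- becomes a coboundary and `φ` becomes zero; as `φ` is onto, the image is everything.
  · let S : Submodule (ZMod ℓ) V := AddSubgroup.toZModSubmodule ℓ ψ.range.toAddSubgroup'
    have hS : ∀ γ, (ψ γ).toAdd ∈ S := fun γ => ⟨γ, rfl⟩
    have hA : S.mkQ ∘ₗ φ = 0 := by
      have hinv : ∀ x y, π x = π y → S.mkQ (f x) = S.mkQ (f y) := by
        intro x y hxy
        obtain ⟨γ, rfl⟩ := (hfib x y).1 hxy
        have h0 : S.mkQ (ψ γ).toAdd = 0 := (Submodule.Quotient.mk_eq_zero S).2 (hS γ)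
        rw [hψ, map_add, h0, zero_add]
      have h0 : Represents ℓ (fun _ : Sing 1 M => (0 : V ⧸ S)) 0 := by
        simpa using hc.map (0 : V →ₗ[ZMod ℓ] V ⧸ S)
      refine Represents.ext ℓ (hc.map S.mkQ) h0 (fun m => S.mkQ (f (Function.surjInv hπ m)))
        fun σ => ?_
      obtain ⟨σ', hσ'⟩ := cov.exists_sing_lift hπ σ
      have hs : π'.comp σ' = σ := ContinuousMap.ext hσ'
      rw [sub_zero, ← hs, hf σ', map_sub]
      congr 1 <;> exact hinv _ _ (Function.surjInv_eq hπ _).symm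
    intro v
    obtain ⟨s, hs⟩ := hφ (Multiplicative.toAdd v)
    have h1 : S.mkQ (φ s) = 0 := LinearMap.congr_fun hA s
    rw [hs] at h1
    exact (Submodule.Quotient.mk_eq_zero S).1 h1
  -- The cocycles `c ∘ g` and `A ∘ c` represent the same map, hence differ by the coboundary of some
  -- `b`. So `f ∘ F - A ∘ f - b ∘ π` is constant; comparing its values at `γ • x₀` and `x₀` gives
  -- the claim.
  · have hA' : φ.comp (firstHomologyMap ℓ g) = A.comp φ := LinearMap.ext hA
    have h1 := hc.comp_map ℓ g
    rw [hA'] at h1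
    obtain ⟨b, hb⟩ := h1.exists_coboundary ℓ (hc.map A)
    have key := eq_of_forall_sing (F := fun x => f (F x) - A (f x) - b (π x)) (fun σ => by
      have h2 := hb (π'.comp σ)
      have h3 : g.comp (π'.comp σ) = π'.comp (F.comp σ) := by
        ext t
        exact (hF (σ t)).symm
      rw [h3, hf, hf, map_sub] at h2
      simp only [ContinuousMap.comp_apply] at h2
      change _ = b (π _) - b (π _) at h2
      rw [eq_comm, ← sub_eq_zero]
      rw [← sub_eq_zero] at h2
      rw [← h2]
      abel) (γ • x₀) x₀
    simp only [hγ, hψ, hΓ, map_add] at key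
    rw [← sub_eq_zero] at key ⊢
    rw [← key]
    abel

/-! ### Splitting the group of lifts -/

section Splitting

/-- A surjective homomorphism whose kernel has order coprime to that of the target splits. -/
lemma MonoidHom.exists_section_of_coprime {Q G : Type*} [Group Q] [Group G] (h : Q →* G)
    (hh : Function.Surjective h) (hc : (Nat.card h.ker).Coprime (Nat.card G)) :
    ∃ s : G →* Q, ∀ g, h (s g) = g := by
  -- Schur–Zassenhaus.
  obtain ⟨K, hK⟩ := Subgroup.exists_right_complement'_of_coprime (N := h.ker) (by
    rwa [Subgroup.index_ker, h.range_eq_top.2 hh, Subgroup.card_top])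
  let f : K →* G := h.comp K.subtype
  have hf : Function.Bijective f := by
    constructor
    · refine (injective_iff_map_eq_one f).2 fun k hk => Subtype.ext ?_
      exact Subgroup.disjoint_def.1 hK.disjoint hk k.2
    · intro g
      obtain ⟨x, rfl⟩ := hh g
      obtain ⟨⟨n, k⟩, hnk⟩ := hK.2 x
      refine ⟨k, ?_⟩
      rw [← hnk, map_mul, n.2, one_mul]
      rfl
  let e := MulEquiv.ofBijective f hf
  exact ⟨K.subtype.comp e.symm.toMonoidHom, e.apply_symm_apply⟩

variable {G V M E : Type*} [Group G] [AddCommGroup V] [MulAction G M]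
  [TopologicalSpace E] [AddAction V E]
  {ℓ : ℕ} [Module (ZMod ℓ) V] {ρ : Representation (ZMod ℓ) G V} {p : E → M}

/-- A homeomorphism of a covering with group `V` that lifts an element of `G` and induces on `V`
the action of this element. -/
def IsEquivariantLift (ρ : Representation (ZMod ℓ) G V) (p : E → M) (g : G) (f : E ≃ₜ E) : Prop :=
  (∀ e, p (f e) = g • p e) ∧ ∀ (v : V) (e : E), f (v +ᵥ e) = ρ g v +ᵥ f e

lemma IsEquivariantLift.mul {g g' : G} {f f' : E ≃ₜ E} (h : IsEquivariantLift ρ p g f)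
    (h' : IsEquivariantLift ρ p g' f') : IsEquivariantLift ρ p (g * g') (f * f') :=
  ⟨fun e => by rw [mul_smul, ← h'.1, ← h.1]; rfl,
    fun v e => by rw [map_mul, Module.End.mul_apply, Homeomorph.mul_apply, h'.2, h.2]; rfl⟩

lemma IsEquivariantLift.one : IsEquivariantLift ρ p 1 (1 : E ≃ₜ E) :=
  ⟨fun e => (one_smul _ _).symm, fun v e => by rw [map_one]; rfl⟩

lemma IsEquivariantLift.inv {g : G} {f : E ≃ₜ E} (h : IsEquivariantLift ρ p g f) :
    IsEquivariantLift ρ p g⁻¹ f⁻¹ := by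
  have hf : ∀ e, f (f⁻¹ e) = e := f.apply_symm_apply
  refine ⟨fun e => ?_, fun v e => f.injective ?_⟩
  · rw [eq_inv_smul_iff, ← h.1, hf]
  · rw [hf, h.2, hf, ← Module.End.mul_apply, ← map_mul, mul_inv_cancel, map_one,
      Module.End.one_apply]

/-- The group of pairs of an element of `G` and a lift. -/
def liftGroup (ρ : Representation (ZMod ℓ) G V) (p : E → M) : Subgroup (G × (E ≃ₜ E)) where
  carrier := {x | IsEquivariantLift ρ p x.1 x.2}
  mul_mem' h h' := h.mul h'
  one_mem' := .one
  inv_mem' h := h.inv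

/-- If every element of `G` lifts to `E`, then the action of `G` lifts to `E`, provided that the
orders of `G` and of the covering group are coprime. -/
lemma IsCoveringMap.exists_lift_action [TopologicalSpace M] [ContinuousConstVAdd V E]
    [ConnectedSpace E] (cov : IsCoveringMap p)
    (free : ∀ (v : V) (e : E), v +ᵥ e = e → v = 0)
    (fibre : ∀ e e' : E, p e = p e' ↔ ∃ v : V, v +ᵥ e = e')
    (hlift : ∀ g : G, ∃ f, IsEquivariantLift ρ p g f)
    (hc : (Nat.card V).Coprime (Nat.card G)) :
    ∃ s : G →* (E ≃ₜ E), ∀ g, IsEquivariantLift ρ p g (s g) := by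
  let h : liftGroup ρ p →* G := (MonoidHom.fst G (E ≃ₜ E)).comp (liftGroup ρ p).subtype
  have hpv : ∀ (v : V) (e : E), p (v +ᵥ e) = p e := fun v e => ((fibre _ _).2 ⟨v, rfl⟩).symm
  -- The kernel consists of the lifts of the identity of `M`. By uniqueness of lifts these are the
  -- translations, so the kernel has the order of `V`.
  let t : V → h.ker := fun v =>
    ⟨⟨(1, Homeomorph.vadd v), fun e => by
      rw [one_smul]; exact hpv v e, fun w e => by
      rw [map_one]; exact vadd_comm v w e⟩, rfl⟩
  have ht : Function.Bijective t := by
    constructor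
    · intro v w hvw
      have h1 : (t v).1.1.2 (Classical.arbitrary E) = (t w).1.1.2 (Classical.arbitrary E) := by
        rw [hvw]
      have h2 : v +ᵥ Classical.arbitrary E = w +ᵥ Classical.arbitrary E := h1
      refine sub_eq_zero.1 (free (v - w) (Classical.arbitrary E) ?_)
      rw [sub_eq_neg_add, add_vadd, h2, neg_vadd_vadd]
    · rintro ⟨⟨⟨g, f⟩, hf⟩, rfl : g = 1⟩
      obtain ⟨v, hv⟩ := (fibre (Classical.arbitrary E) (f (Classical.arbitrary E))).1
        (by rw [hf.1, one_smul])
      refine ⟨v, Subtype.ext (Subtype.ext (Prod.ext rfl (Homeomorph.ext fun e => ?_)))⟩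
      refine congrFun (cov.eq_of_comp_eq (continuous_const_vadd v) f.continuous
        (funext fun e => ?_) (Classical.arbitrary E) hv) e
      rw [Function.comp_apply, Function.comp_apply, hf.1, hpv, one_smul]
  obtain ⟨s, hs⟩ := h.exists_section_of_coprime
    (fun g => let ⟨f, hf⟩ := hlift g; ⟨⟨(g, f), hf⟩, rfl⟩)
    (by rwa [← Nat.card_congr (Equiv.ofBijective t ht)])
  refine ⟨(MonoidHom.snd G (E ≃ₜ E)).comp ((liftGroup ρ p).subtype.comp s), fun g => ?_⟩
  have h1 : IsEquivariantLift ρ p (h (s g)) (s g).1.2 := (s g).2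
  rwa [hs] at h1

end Splitting

/-- The action of the wreath product given by compatible actions of its two factors. -/
@[reducible] def wreathAction (ℓ : ℕ) {G E : Type*} [Group G] (H : Subgroup G) [TopologicalSpace E]
    [AddAction (G ⧸ H → ZMod ℓ) E] (s : G →* (E ≃ₜ E))
    (hs : ∀ g (v : G ⧸ H → ZMod ℓ) (e : E), s g (v +ᵥ e) = cosetFunRep ℓ H g v +ᵥ s g e) :
    MulAction (WreathProduct ℓ H) E where
  smul k e := (fun c => (k.left c).toAdd : G ⧸ H → ZMod ℓ) +ᵥ s k.right e
  one_smul e := by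
    change (0 : G ⧸ H → ZMod ℓ) +ᵥ s 1 e = e
    rw [map_one, zero_vadd]
    rfl
  mul_smul a b e := by
    change (((fun c => (a.left c).toAdd) + cosetFunRep ℓ H a.right fun c => (b.left c).toAdd :
      G ⧸ H → ZMod ℓ)) +ᵥ s (a.right * b.right) e = _
    rw [add_vadd, map_mul, Homeomorph.mul_apply, ← hs]
    rfl

/-! ### Lifting to the simply connected covering -/

section HomeomorphLift

variable {X M : Type*} [TopologicalSpace X] [TopologicalSpace M] [SimplyConnectedSpace X]
  {π : X → M}

/-- Lifts of `g ∘ π` and `g⁻¹ ∘ π` with matching base points are mutually inverse, since their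
composites lift `π` and fix a point. -/
lemma IsCoveringMap.exists_homeomorph_lift [LocallyPathConnectedSpace X] (cov : IsCoveringMap π)
    (hπ : Function.Surjective π) (g : M ≃ₜ M) : ∃ F : X ≃ₜ X, ∀ x, π (F x) = g (π x) := by
  let x₀ : X := Classical.arbitrary X
  obtain ⟨y, hy⟩ := hπ (g (π x₀))
  obtain ⟨F, ⟨hF₀, hF⟩, -⟩ := cov.existsUnique_continuousMap_lifts
    (⟨fun x => g (π x), g.continuous.comp cov.continuous⟩ : C(X, M)) x₀ y hy
  obtain ⟨F', ⟨hF'₀, hF'⟩, -⟩ := cov.existsUnique_continuousMap_lifts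
    (⟨fun x => g.symm (π x), g.symm.continuous.comp cov.continuous⟩ : C(X, M)) y x₀
    (by simp [hy])
  replace hF : ∀ x, π (F x) = g (π x) := congrFun hF
  replace hF' : ∀ x, π (F' x) = g.symm (π x) := congrFun hF'
  have h1 : F' ∘ F = id := cov.eq_of_comp_eq (F'.continuous.comp F.continuous) continuous_id
    (funext fun x => by simp [hF', hF]) x₀ (by simp [hF₀, hF'₀])
  have h2 : F ∘ F' = id := cov.eq_of_comp_eq (F.continuous.comp F'.continuous) continuous_id
    (funext fun x => by simp [hF', hF]) y (by simp [hF₀, hF'₀])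
  exact ⟨⟨⟨F, F', congrFun h1, congrFun h2⟩, F.continuous, F'.continuous⟩, hF⟩

/-- `F ∘ γ` and `γ' ∘ F` both lift `g ∘ π`; `γ'` is chosen so that they agree at one point. -/
lemma IsCoveringMap.exists_lift_smul {Γ : Type*} [Group Γ] [MulAction Γ X]
    [ContinuousConstSMul Γ X] (cov : IsCoveringMap π)
    (hfib : ∀ x y, π x = π y ↔ ∃ γ : Γ, γ • x = y) {g : M → M} {F : X → X} (hF : Continuous F)
    (hg : ∀ x, π (F x) = g (π x)) (γ : Γ) : ∃ γ' : Γ, ∀ x, F (γ • x) = γ' • F x := by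
  have hΓ : ∀ (γ : Γ) (x : X), π (γ • x) = π x := fun γ x => ((hfib _ _).2 ⟨γ, rfl⟩).symm
  let x₀ : X := Classical.arbitrary X
  obtain ⟨γ', h⟩ := (hfib (F x₀) (F (γ • x₀))).1 (by rw [hg, hg, hΓ])
  refine ⟨γ', congrFun (cov.eq_of_comp_eq (hF.comp (continuous_const_smul γ))
    ((continuous_const_smul γ').comp hF) (funext fun x => ?_) x₀ h.symm)⟩
  simp only [Function.comp_apply, hg, hΓ]

end HomeomorphLift

/-! ### The covering given by the kernel of ψ -/

section DeckQuotient

variable {X Γ V : Type*} [Group Γ] [MulAction Γ X] [AddCommGroup V] (ψ : Γ →* Multiplicative V)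

/-- The intermediate covering given by the kernel of a homomorphism on the covering group. -/
abbrev DeckQuotient (X : Type*) [MulAction Γ X] : Type _ := MulAction.orbitRel.Quotient ψ.ker X

/-- The class of a point. -/
def DeckQuotient.mk (x : X) : DeckQuotient ψ X := Quotient.mk _ x

namespace DeckQuotient

lemma mk_eq_mk {x y : X} : mk ψ x = mk ψ y ↔ ∃ γ : Γ, ψ γ = 1 ∧ γ • x = y := by
  rw [eq_comm]
  refine Quotient.eq.trans ?_
  constructor
  · rintro ⟨⟨γ, hγ⟩, h⟩
    exact ⟨γ, hγ, h⟩
  · rintro ⟨γ, hγ, h⟩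
    exact ⟨⟨γ, hγ⟩, h⟩

lemma mk_surjective : Function.Surjective (mk ψ : X → DeckQuotient ψ X) := Quotient.mk_surjective

/-- A map on the quotient induced by an equivariant map. -/
def map (F : X → X) (h : ∀ x y, mk ψ x = mk ψ y → mk ψ (F x) = mk ψ (F y)) :
    DeckQuotient ψ X → DeckQuotient ψ X :=
  Quotient.lift (fun x => mk ψ (F x)) fun x y hxy => h x y (Quotient.sound hxy)

lemma map_mk (F : X → X) (h : ∀ x y, mk ψ x = mk ψ y → mk ψ (F x) = mk ψ (F y)) (x : X) :
    map ψ F h (mk ψ x) = mk ψ (F x) := rfl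

/-- As the kernel is normal, Γ acts on the quotient, and only through the value of `ψ`. Hence the
choice of preimages in `addAction` is immaterial. -/
lemma mk_smul_eq {γ γ' : Γ} (h : ψ γ = ψ γ') {x y : X} (hxy : mk ψ x = mk ψ y) :
    mk ψ (γ • x) = mk ψ (γ' • y) := by
  obtain ⟨k, hk, rfl⟩ := (mk_eq_mk ψ).1 hxy
  refine (mk_eq_mk ψ).2 ⟨γ' * k * γ⁻¹, ?_, ?_⟩
  · rw [map_mul, map_mul, map_inv, hk, h, mul_one, mul_inv_cancel]
  · simp only [mul_smul, inv_smul_smul]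

variable {ψ} (hψ : Function.Surjective ψ)

/-- The action of the residual covering group. -/
@[reducible] def addAction : AddAction V (DeckQuotient ψ X) where
  vadd v := map ψ (fun x => Function.surjInv hψ (.ofAdd v) • x) fun _ _ h => mk_smul_eq ψ rfl h
  zero_vadd e := by
    obtain ⟨x, rfl⟩ := mk_surjective ψ e
    refine (mk_smul_eq ψ (γ' := 1) ?_ rfl).trans (by rw [one_smul])
    rw [Function.surjInv_eq hψ, map_one]
    rfl
  add_vadd v w e := by
    obtain ⟨x, rfl⟩ := mk_surjective ψ e
    refine (mk_smul_eq ψ (γ' := Function.surjInv hψ (.ofAdd v) * Function.surjInv hψ (.ofAdd w))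
      ?_ rfl).trans (by rw [mul_smul]; rfl)
    rw [Function.surjInv_eq hψ, map_mul, Function.surjInv_eq hψ, Function.surjInv_eq hψ, ofAdd_add]

lemma vadd_mk (γ : Γ) (x : X) :
    letI := addAction (X := X) hψ
    (ψ γ).toAdd +ᵥ mk ψ x = mk ψ (γ • x) :=
  mk_smul_eq ψ (Function.surjInv_eq hψ _) rfl

section Proj

variable {M : Type*} {π : X → M} (hfib : ∀ x y, π x = π y ↔ ∃ γ : Γ, γ • x = y)

/-- The projection from the intermediate covering. -/
def proj (π : X → M) (hfib : ∀ x y, π x = π y ↔ ∃ γ : Γ, γ • x = y) : DeckQuotient ψ X → M :=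
  Quotient.lift π fun x y hxy => by
    obtain ⟨γ, -, h⟩ := (mk_eq_mk ψ).1 (Quotient.sound hxy)
    exact (hfib x y).2 ⟨γ, h⟩

lemma proj_mk (x : X) : proj π hfib (mk ψ x) = π x := rfl

lemma proj_fibre (e e' : DeckQuotient ψ X) :
    letI := addAction (X := X) hψ
    proj π hfib e = proj π hfib e' ↔ ∃ v : V, v +ᵥ e = e' := by
  let _ := addAction (X := X) hψ
  obtain ⟨x, rfl⟩ := mk_surjective ψ e
  obtain ⟨y, rfl⟩ := mk_surjective ψ e'
  rw [proj_mk, proj_mk, hfib]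
  constructor
  · rintro ⟨γ, rfl⟩
    exact ⟨_, vadd_mk hψ γ x⟩
  · rintro ⟨v, hv⟩
    obtain ⟨γ, hγ⟩ := hψ (.ofAdd v)
    have h := vadd_mk hψ γ x
    rw [hγ] at h
    obtain ⟨k, -, h'⟩ := (mk_eq_mk ψ).1 (h.symm.trans hv)
    exact ⟨k * γ, by rw [mul_smul, h']⟩

lemma vadd_free (free : ∀ (γ : Γ) (x : X), γ • x = x → γ = 1) (v : V) (e : DeckQuotient ψ X) :
    letI := addAction (X := X) hψ
    v +ᵥ e = e → v = 0 := by
  let _ := addAction (X := X) hψ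
  intro h
  obtain ⟨x, rfl⟩ := mk_surjective ψ e
  obtain ⟨γ, hγ⟩ := hψ (.ofAdd v)
  have h' := vadd_mk hψ γ x
  rw [hγ] at h'
  obtain ⟨k, hk, h''⟩ := (mk_eq_mk ψ).1 (h'.symm.trans h)
  have := free (k * γ) x (by rw [mul_smul, h''])
  have h1 := congrArg ψ this
  rw [map_mul, hk, hγ, one_mul, map_one] at h1
  exact h1

variable [TopologicalSpace X] [TopologicalSpace M]

lemma continuous_mk : Continuous (mk ψ : X → DeckQuotient ψ X) := continuous_quotient_mk'

lemma isQuotientMap_mk : Topology.IsQuotientMap (mk ψ : X → DeckQuotient ψ X) :=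
  isQuotientMap_quotient_mk'

lemma continuous_map {F : X → X} (hF : Continuous F)
    (h : ∀ x y, mk ψ x = mk ψ y → mk ψ (F x) = mk ψ (F y)) : Continuous (map ψ F h) :=
  isQuotientMap_mk.continuous_iff.2 (continuous_mk.comp hF)

lemma continuousConstVAdd [ContinuousConstSMul Γ X] :
    letI := addAction (X := X) hψ
    ContinuousConstVAdd V (DeckQuotient ψ X) :=
  letI := addAction (X := X) hψ
  ⟨fun _ => continuous_map (continuous_const_smul _) _⟩

/-- Elements of `G` lift to the intermediate covering of an equivariant homomorphism. -/
lemma exists_isEquivariantLift [SimplyConnectedSpace X] [LocallyPathConnectedSpace X]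
    [ContinuousConstSMul Γ X] (cov : IsCoveringMap π) (hπ : Function.Surjective π)
    {G : Type*} [Group G] [MulAction G M] [ContinuousConstSMul G M] {ℓ : ℕ} [Module (ZMod ℓ) V]
    {ρ : Representation (ZMod ℓ) G V}
    (hρ : ∀ (g : G) (F : C(X, X)), (∀ x, π (F x) = g • π x) →
      ∀ γ γ' : Γ, (∀ x, F (γ • x) = γ' • F x) → (ψ γ').toAdd = ρ g (ψ γ).toAdd) (g : G) :
    letI := addAction (X := X) hψ
    ∃ f, IsEquivariantLift ρ (proj (ψ := ψ) π hfib) g f := by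
  let _ := addAction (X := X) hψ
  obtain ⟨F, hF⟩ := cov.exists_homeomorph_lift hπ (Homeomorph.smul g)
  have hF' : ∀ x, π (F.symm x) = g⁻¹ • π x := fun x => by
    rw [eq_inv_smul_iff]
    simpa using (hF (F.symm x)).symm
  -- By `hρ`, moving `γ` past `F` changes its value under `ψ` by the linear map `ρ g`, so the kernel
  -- is preserved. Stated for every `g` because the inverse of `F` lifts `g⁻¹`.
  have key : ∀ (g : G) (F : X → X) (_ : Continuous F) (_ : ∀ x, π (F x) = g • π x) (x y : X),
      mk ψ x = mk ψ y → mk ψ (F x) = mk ψ (F y) := by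
    intro g F hFc hF x y hxy
    obtain ⟨γ, hγ, rfl⟩ := (mk_eq_mk ψ).1 hxy
    obtain ⟨γ', hγ'⟩ := cov.exists_lift_smul hfib (g := fun m => g • m) hFc hF γ
    refine (mk_eq_mk ψ).2 ⟨γ', ?_, (hγ' x).symm⟩
    have := hρ g ⟨F, hFc⟩ hF γ γ' hγ'
    rw [hγ, toAdd_one, map_zero] at this
    exact this
  let f : DeckQuotient ψ X ≃ₜ DeckQuotient ψ X :=
    { toFun := map ψ F (key g F F.continuous hF)
      invFun := map ψ F.symm (key g⁻¹ F.symm F.symm.continuous hF')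
      left_inv e := by
        obtain ⟨x, rfl⟩ := mk_surjective ψ e
        rw [map_mk, map_mk, F.symm_apply_apply]
      right_inv e := by
        obtain ⟨x, rfl⟩ := mk_surjective ψ e
        rw [map_mk, map_mk, F.apply_symm_apply]
      continuous_toFun := continuous_map F.continuous _
      continuous_invFun := continuous_map F.symm.continuous _ }
  refine ⟨f, fun e => ?_, fun v e => ?_⟩
  · obtain ⟨x, rfl⟩ := mk_surjective ψ e
    exact hF x
  · obtain ⟨x, rfl⟩ := mk_surjective ψ e
    obtain ⟨γ, hγ⟩ := hψ (.ofAdd v)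
    obtain ⟨γ', hγ'⟩ := cov.exists_lift_smul hfib (g := fun m => g • m) F.continuous hF γ
    have h1 := hρ g ⟨F, F.continuous⟩ hF γ γ' hγ'
    have h2 := vadd_mk hψ γ x
    rw [hγ, toAdd_ofAdd] at h1 h2
    rw [h2, ← h1]
    change mk ψ (F (γ • x)) = _ +ᵥ mk ψ (F x)
    rw [vadd_mk, hγ']

end Proj

end DeckQuotient

end DeckQuotient

/-! ### Free actions, coverings and compactness -/

section FreeActions

variable {E B : Type*} [TopologicalSpace E] [TopologicalSpace B] [T2Space E]
  [LocallyCompactSpace E] {f : E → B}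

lemma Topology.IsQuotientMap.isCoveringMap_of_smul {K : Type*} [Group K] [MulAction K E]
    [ContinuousConstSMul K E] [ProperlyDiscontinuousSMul K E] (hf : Topology.IsQuotientMap f)
    (free : ∀ (k : K) (x : E), k • x = x → k = 1)
    (fibre : ∀ x y : E, f x = f y ↔ ∃ k : K, k • x = y) : IsCoveringMap f := by
  have : IsCancelSMul K E := isCancelSMul_iff_eq_one_of_smul_eq.2 free
  exact (hf.isQuotientCoveringMap_of_properlyDiscontinuousSMul (G := K)
    fun {x y} => eq_comm.trans (fibre y x)).isCoveringMap

lemma Topology.IsQuotientMap.isCoveringMap_of_vadd {V : Type*} [AddGroup V] [AddAction V E]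
    [ContinuousConstVAdd V E] [ProperlyDiscontinuousVAdd V E] (hf : Topology.IsQuotientMap f)
    (free : ∀ (v : V) (x : E), v +ᵥ x = x → v = 0)
    (fibre : ∀ x y : E, f x = f y ↔ ∃ v : V, v +ᵥ x = y) : IsCoveringMap f := by
  have : IsCancelVAdd V E := isCancelVAdd_iff_eq_zero_of_vadd_eq.2 free
  exact (hf.isAddQuotientCoveringMap_of_properlyDiscontinuousVAdd (G := V)
    fun {x y} => eq_comm.trans (fibre y x)).isCoveringMap


end FreeActions

/-- The saturation of a closed set is a finite union of translates, so the map is closed; having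
finite fibres, it is proper. -/
lemma Topology.IsQuotientMap.compactSpace_of_vadd {E B V : Type*} [TopologicalSpace E]
    [TopologicalSpace B] [AddGroup V] [Finite V] [AddAction V E] [ContinuousConstVAdd V E]
    [CompactSpace B] {f : E → B} (hf : Topology.IsQuotientMap f)
    (fibre : ∀ x y : E, f x = f y ↔ ∃ v : V, v +ᵥ x = y) : CompactSpace E := by
  have : IsProperMap f := by
    refine isProperMap_iff_isClosedMap_and_compact_fibers.2 ⟨hf.continuous, fun C hC => ?_,
      fun b => ?_⟩
    · have h : f ⁻¹' (f '' C) = ⋃ v : V, (v +ᵥ ·) '' C := by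
        ext e
        simp only [Set.mem_preimage, Set.mem_image, Set.mem_iUnion, fibre]
        exact ⟨fun ⟨x, hx, v, hv⟩ => ⟨v, x, hx, hv⟩, fun ⟨v, x, hx, hv⟩ => ⟨x, hx, v, hv⟩⟩
      rw [← hf.isClosed_preimage, h]
      exact isClosed_iUnion_of_finite fun v => (Homeomorph.vadd v).isClosedMap C hC
    · obtain ⟨e, rfl⟩ := hf.surjective b
      have h : f ⁻¹' {f e} = Set.range fun v : V => v +ᵥ e := by
        ext x
        simp only [Set.mem_preimage, Set.mem_singleton_iff, Set.mem_range]
        rw [eq_comm, fibre]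
      rw [h]
      exact (Set.finite_range _).isCompact
  exact ⟨by simpa using this.isCompact_preimage isCompact_univ⟩

namespace RiemMfd

variable {d : ℕ} {X Y : RiemMfd.{u} d}

instance (X : RiemMfd.{u} d) : LocallyCompactSpace X :=
  ChartedSpace.locallyCompactSpace (EuclideanSpace ℝ (Fin d)) X

lemma isGaloisCovering_of_isQuotientMap {K : Type*} [Group K] [MulAction K X]
    [ProperlyDiscontinuousSMul K X] {f : X → Y} (hf : Topology.IsQuotientMap f)
    (hloc : IsLocalIsometry f) (hact : ActsByIsometries K X)
    (free : ∀ (k : K) (x : X), k • x = x → k = 1)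
    (fibre : ∀ x y : X, f x = f y ↔ ∃ k : K, k • x = y) : IsGaloisCovering K f :=
  have := hact.continuousConstSMul
  ⟨⟨hf.isCoveringMap_of_smul free fibre, hf.surjective, hloc⟩, hact, free, fibre⟩

end RiemMfd

/-! ### (B) implies (A) -/

section WreathOnCover

variable {ℓ : ℕ} {G E : Type*} [Group G] {H : Subgroup G} [TopologicalSpace E]
  [AddAction (G ⧸ H → ZMod ℓ) E] {s : G →* (E ≃ₜ E)}
  (hs : ∀ g (v : G ⧸ H → ZMod ℓ) (e : E), s g (v +ᵥ e) = cosetFunRep ℓ H g v +ᵥ s g e)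

lemma wreathVec_mul_inr_smul (v : G ⧸ H → ZMod ℓ) (g : G) (e : E) :
    letI := wreathAction ℓ H s hs
    (wreathVec ℓ H v * SemidirectProduct.inr g : WreathProduct ℓ H) • e = v +ᵥ s g e := by
  let _ := wreathAction ℓ H s hs
  change (fun c => (Multiplicative.toAdd _) : G ⧸ H → ZMod ℓ) +ᵥ s _ e = _
  congr 1
  · ext c
    simp [wreathVec]
  · simp [wreathVec]

lemma exists_wreathVec_mul_inr (k : WreathProduct ℓ H) :
    ∃ v, wreathVec ℓ H v * SemidirectProduct.inr k.right = k :=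
  ⟨fun c => (k.left c).toAdd, SemidirectProduct.inl_left_mul_inr_right k⟩

end WreathOnCover

/-- A covering of `M` with group `C^n` to which the action of `G` lifts compatibly gives a wreath
product covering. -/
theorem extendsToWreathCover_of_lift {ℓ d : ℕ} {G : Type*} [Group G] [NeZero ℓ]
    {H : Subgroup G} {M₀ : DevelopableOrbifold.{u} d} {M M₁ : RiemMfd.{u} d} [CompactSpace M]
    [MulAction G M] {q : M → M₀.Space} {q₁ : M → M₁} (hq : M₀.IsGaloisCovering G q)
    (hq₁ : RiemMfd.IsGaloisCovering H q₁) {E : Type u} [TopologicalSpace E] [T2Space E]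
    [SecondCountableTopology E] [ConnectedSpace E] [AddAction (G ⧸ H → ZMod ℓ) E]
    [ContinuousConstVAdd (G ⧸ H → ZMod ℓ) E] {p : E → M} (cov : IsCoveringMap p)
    (hp : Function.Surjective p) (free : ∀ (v : G ⧸ H → ZMod ℓ) (e : E), v +ᵥ e = e → v = 0)
    (fibre : ∀ e e' : E, p e = p e' ↔ ∃ v : G ⧸ H → ZMod ℓ, v +ᵥ e = e')
    {s : G →* (E ≃ₜ E)} (hs : ∀ g, IsEquivariantLift (cosetFunRep ℓ H) p g (s g))
    (hqp : M₀.IsCovering (X := M.pullback cov.isLocalHomeomorph)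
      (q ∘ M.pullbackProj cov.isLocalHomeomorph)) :
    ExtendsToWreathCover ℓ H q q₁ := by
  have := hq.finite
  have hpl := cov.isLocalHomeomorph
  have hpi := M.isLocalIsometry_pullback hpl
  let M' := M.pullback hpl
  let π : M' → M := M.pullbackProj hpl
  let act : MulAction (WreathProduct ℓ H) M' := wreathAction (E := E) ℓ H s fun g => (hs g).2
  have hact : ∀ (v : G ⧸ H → ZMod ℓ) (g : G) (x : M'),
      (wreathVec ℓ H v * SemidirectProduct.inr g : WreathProduct ℓ H) • x
        = (v +ᵥ s g (show E from x) : E) := wreathVec_mul_inr_smul fun g => (hs g).2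
  have hpv : ∀ (v : G ⧸ H → ZMod ℓ) (e : E), p (v +ᵥ e) = p e := fun v e =>
    ((fibre _ _).2 ⟨v, rfl⟩).symm
  have hπ : ∀ (k : WreathProduct ℓ H) (x : M'), π (k • x) = k.right • π x := by
    intro k x
    obtain ⟨v, hv⟩ := exists_wreathVec_mul_inr k
    rw [← hv, hact]
    refine ((hpv v _).trans ((hs k.right).1 x)).trans ?_
    rw [hv]
    rfl
  have hisom : RiemMfd.ActsByIsometries (WreathProduct ℓ H) M' := by
    intro k
    obtain ⟨v, hv⟩ := exists_wreathVec_mul_inr k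
    refine RiemMfd.isLocalIsometry_of_comp_pullback M hpl ?_ ?_
    · have h : (fun x : M' => k • x) = fun e : E => (v +ᵥ s k.right e : E) := by
        funext e
        rw [← hact, hv]
      have hc : Continuous fun e : E => v +ᵥ s k.right e :=
        (continuous_const_vadd v).comp (s k.right).continuous
      rw [h]
      exact hc
    · have h : (M.pullbackProj hpl ∘ fun x : M' => k • x)
          = (fun m : M => k.right • m) ∘ M.pullbackProj hpl := funext (hπ k)
      rw [h]
      exact (hq.actsByIsometries k.right).comp hpi
  -- Only elements over 1 are claimed to act freely, since G may have fixed points on M. Elements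
  -- over H reduce to this case, as H acts freely on M.
  have hfree : ∀ (k : WreathProduct ℓ H) (x : M'), k.right = 1 → k • x = x → k = 1 := by
    intro k x hk hx
    obtain ⟨v, hv⟩ := exists_wreathVec_mul_inr k
    rw [hk] at hv
    rw [← hv, hact, map_one] at hx
    rw [free v (show E from x) hx, wreathVec_zero, map_one, one_mul] at hv
    exact hv.symm
  -- Lift `g` by `s g` and correct by a translation; all three fibre conditions follow from this.
  have htrans : ∀ (g : G) (x y : M'), g • π x = π y →
      ∃ k : WreathProduct ℓ H, k.right = g ∧ k • x = y := by
    intro g x y h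
    obtain ⟨v, hv⟩ := (fibre (s g x) y).1 (((hs g).1 x).trans h)
    refine ⟨wreathVec ℓ H v * SemidirectProduct.inr g, ?_, (hact v g x).trans hv⟩
    simp [wreathVec]
  have : Finite (G ⧸ H → Multiplicative (ZMod ℓ)) := inferInstance
  have : Finite (WreathProduct ℓ H) := Finite.of_equiv _ SemidirectProduct.equivProd.symm
  have hπq : Topology.IsQuotientMap π := cov.isQuotientMap hp
  refine ⟨M', act, π, (cov.isQuotientMap hp).compactSpace_of_vadd fibre, hπ, ?_, ?_, ?_⟩
  · refine RiemMfd.isGaloisCovering_of_isQuotientMap hπq hpi (fun k => hisom k) ?_ ?_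
    · rintro ⟨k, hk⟩ x h
      obtain ⟨v, rfl⟩ := exists_wreathVec ℓ H hk
      exact Subtype.ext (hfree _ x rfl h)
    · intro x y
      constructor
      · intro h
        obtain ⟨k, hk, hkx⟩ := htrans 1 x y (by rw [one_smul, h])
        obtain ⟨v, hv⟩ := exists_wreathVec_mul_inr k
        refine ⟨⟨k, ?_⟩, hkx⟩
        rw [← hv, hk, map_one, mul_one]
        exact wreathVec_mem ℓ H v
      · rintro ⟨⟨k, hk⟩, rfl⟩
        obtain ⟨v, rfl⟩ := exists_wreathVec ℓ H hk
        change π x = π (wreathVec ℓ H v • x)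
        rw [hπ]
        exact (one_smul G _).symm
  · refine RiemMfd.isGaloisCovering_of_isQuotientMap
      ((hq₁.isRiemannianCovering.isCoveringMap.isQuotientMap
        hq₁.isRiemannianCovering.surjective).comp hπq)
      (hq₁.isRiemannianCovering.isLocalIsometry.comp hpi) (fun k => hisom k) ?_ ?_
    · rintro ⟨k, hk : k.right ∈ H⟩ x h
      have h' : k • x = x := h
      have h1 : k.right • π x = π x := by rw [← hπ, h']
      exact Subtype.ext (hfree k x (congrArg Subtype.val (hq₁.free ⟨k.right, hk⟩ _ h1)) h')
    · intro x y
      refine (hq₁.fibre (π x) (π y)).trans ?_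
      constructor
      · rintro ⟨⟨h, hh⟩, hxy⟩
        obtain ⟨k, hk, hkx⟩ := htrans h x y hxy
        exact ⟨⟨k, show k.right ∈ H from hk ▸ hh⟩, hkx⟩
      · rintro ⟨⟨k, hk⟩, rfl⟩
        exact ⟨⟨k.right, hk⟩, (hπ k x).symm⟩
  · refine ⟨hqp, inferInstance, hisom, ⟨fun {k k'} h => ?_⟩, fun x y => ?_⟩
    · have hfaith := hq.faithful
      have h1 : k.right = k'.right := hfaith.eq_of_smul_eq_smul fun m => by
        obtain ⟨x, rfl⟩ := hp m
        exact (hπ k x).symm.trans ((congrArg π (h x)).trans (hπ k' x))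
      refine (inv_mul_eq_one.1 (hfree (k'⁻¹ * k) (Classical.arbitrary M') ?_ ?_)).symm
      · rw [SemidirectProduct.mul_right, SemidirectProduct.inv_right, h1, inv_mul_cancel]
      · rw [mul_smul, h, inv_smul_smul]
    · refine (hq.fibre (π x) (π y)).trans ?_
      constructor
      · rintro ⟨g, hg⟩
        obtain ⟨k, -, hk⟩ := htrans g x y hg
        exact ⟨k, hk⟩
      · rintro ⟨k, rfl⟩
        exact ⟨k.right, (hπ k x).symm⟩

/-- If the order of `G` is prime to `ℓ` and the induced module is a quotient of the homology, then
there is a wreath product covering. -/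
theorem extendsToWreathCover_of_isQuotientModule {ℓ d : ℕ} [Fact ℓ.Prime] {G : Type*} [Group G]
    {H : Subgroup G} {M₀ : DevelopableOrbifold.{u} d} {M M₁ : RiemMfd.{u} d} [CompactSpace M]
    [MulAction G M] [ContinuousConstSMul G M] {q : M → M₀.Space} {q₁ : M → M₁}
    (hq : M₀.IsGaloisCovering G q) (hq₁ : RiemMfd.IsGaloisCovering H q₁)
    (hℓ : ¬ ℓ ∣ Nat.card G)
    (h : IsQuotientModule (firstHomologyRep ℓ G M) (indTrivialMod ℓ H)) :
    ExtendsToWreathCover ℓ H q q₁ := by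
  have := hq.finite
  obtain ⟨φ, hφ, hρ⟩ := (isQuotientModule_indTrivialMod_iff ℓ H _).1 h
  obtain ⟨Γ, π, hπ, hqπ⟩ := hq.isCovering
  have := M₀.simplyConnected
  have := M₀.discrete
  have := hπ.actsByIsometries.continuousConstSMul
  have cov := hπ.isRiemannianCovering.isCoveringMap
  have hsurj := hπ.isRiemannianCovering.surjective
  obtain ⟨ψ, hψ, hnat⟩ := exists_deck_hom ℓ cov hsurj hπ.fibre hφ
  have : ContinuousConstSMul ψ.ker M₀.cover := ⟨fun k => continuous_const_smul (k : Γ)⟩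
  let E := DeckQuotient ψ M₀.cover
  let _ : AddAction (G ⧸ H → ZMod ℓ) E := DeckQuotient.addAction hψ
  have : ContinuousConstVAdd (G ⧸ H → ZMod ℓ) E := DeckQuotient.continuousConstVAdd hψ
  have : SecondCountableTopology E := ContinuousConstSMul.secondCountableTopology
  have : LocallyCompactSpace E :=
    (MulAction.isOpenQuotientMap_quotientMk (Γ := ψ.ker) (T := M₀.cover)).locallyCompactSpace
  let p : E → M := DeckQuotient.proj π hπ.fibre
  -- The composite of `p` with the projection from the universal cover is the covering `π`.
  have hpq : Topology.IsQuotientMap p :=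
    .of_comp_isQuotientMap DeckQuotient.isQuotientMap_mk (cov.isQuotientMap hsurj)
  have hfree : ∀ (v : G ⧸ H → ZMod ℓ) (e : E), v +ᵥ e = e → v = 0 :=
    DeckQuotient.vadd_free hψ hπ.free
  have hfibre : ∀ e e' : E, p e = p e' ↔ ∃ v : G ⧸ H → ZMod ℓ, v +ᵥ e = e' :=
    DeckQuotient.proj_fibre hψ hπ.fibre
  have covp : IsCoveringMap p := hpq.isCoveringMap_of_vadd hfree hfibre
  obtain ⟨s, hs⟩ := covp.exists_lift_action (ρ := cosetFunRep ℓ H) hfree hfibre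
    (DeckQuotient.exists_isEquivariantLift hψ hπ.fibre cov hsurj fun g F hF γ γ' hγ =>
      hnat ⟨fun m => g • m, continuous_const_smul g⟩ (cosetFunRep ℓ H g) (hρ g) F hF γ γ' hγ)
    (by
      have : Fintype (G ⧸ H) := Fintype.ofFinite _
      rw [Nat.card_fun, Nat.card_zmod]
      exact .pow_left _ (((Fact.out : ℓ.Prime).coprime_iff_not_dvd).2 hℓ))
  refine extendsToWreathCover_of_lift hq hq₁ covp hpq.surjective hfree hfibre hs ?_
  -- As an orbifold covering of M₀, the new manifold is the quotient of the universal cover by ker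
  -- ψ, viewed inside the orbifold group.
  refine ⟨ψ.ker.map Γ.subtype, DeckQuotient.mk ψ, ?_, hqπ⟩
  have hmkq : Topology.IsQuotientMap (DeckQuotient.mk ψ : M₀.cover → E) :=
    DeckQuotient.isQuotientMap_mk
  refine RiemMfd.isGaloisCovering_of_isQuotientMap hmkq
    (RiemMfd.isLocalIsometry_of_comp_pullback M covp.isLocalHomeomorph hmkq.continuous
      hπ.isRiemannianCovering.isLocalIsometry) (fun k => M₀.isometries k) ?_ ?_
  · rintro ⟨-, k, hk, rfl⟩ x hx
    have : k = 1 := hπ.free k x hx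
    subst this
    rfl
  · intro x y
    refine (DeckQuotient.mk_eq_mk ψ).trans ?_
    constructor
    · rintro ⟨γ, hγ, h⟩
      exact ⟨⟨γ, γ, hγ, rfl⟩, h⟩
    · rintro ⟨⟨-, γ, hγ, rfl⟩, h⟩
      exact ⟨γ, hγ, h⟩

end

theorem mainTheorem6 {d : ℕ} (M₀ : DevelopableOrbifold.{u} d) (M M₁ : RiemMfd.{u} d)
    [CompactSpace M] {G : Type*} [Group G] [MulAction G M] [ContinuousConstSMul G M]
    (H₁ : Subgroup G) (q : M → M₀.Space) (q₁ : M → M₁) (p₁ : M₁ → M₀.Space)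
    (hq : M₀.IsGaloisCovering G q) (hq₁ : RiemMfd.IsGaloisCovering H₁ q₁)
    (hp₁ : M₀.IsCovering p₁) (hcomm : p₁ ∘ q₁ = q) (ℓ : ℕ) [Fact ℓ.Prime] :
    (ExtendsToWreathCover ℓ H₁ q q₁ →
      IsQuotientModule (firstHomologyRep ℓ G M) (indTrivialMod ℓ H₁)) ∧
    (¬ ℓ ∣ Nat.card G →
      (ExtendsToWreathCover ℓ H₁ q q₁ ↔
        IsQuotientModule (firstHomologyRep ℓ G M) (indTrivialMod ℓ H₁))) := by
  have := hq.finite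
  exact ⟨fun h => h.isQuotientModule, fun hℓ =>
    ⟨fun h => h.isQuotientModule, extendsToWreathCover_of_isQuotientModule hq hq₁ hℓ⟩⟩
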